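/- Let $(M,g)$ be a smooth Riemannian manifold of dimension $m$, let $P\in M$, and let $\nabla$ be the Levi-Civita connection with curvature $R(X,Y)=\nabla_X\nabla_Y-\nabla_Y\nabla_X-\nabla_{[X,Y]}$ and $R(X,Y,Z,W)=g(R(X,Y)Z,W)$. For $\xi\in T_PM$ and $k\ge 0$ let $\mathcal J_k(\xi)=\nabla_\xi^k\mathcal J(\xi)$ be the endomorphism of $T_PM$ with $$g(\mathcal J_k(\xi)\eta,\zeta)=(\nabla^kR)(\eta,\xi,\xi,\zeta;\xi,\dots,\xi)\qquad(\eta,\zeta\in T_PM),$$ so that $\mathcal J=\mathcal J_0$, $\mathcal J(\xi)\eta=R(\eta,\xi)\xi$, is the Jacobi operator. Let $g_{ij}(\xi)=g\big(d(\exp_P)_\xi e_i,\,d(\exp_P)_\xi e_j\big)$ be the components of the metric in normal coordinates at $P$ with respect to an orthonormal basis $e_1,\dots,e_m$ of $T_PM$. Then $\exp_P$ is defined near $0\in T_PM$, the volume density $\tilde\Theta(\xi)=\sqrt{\det(g_{ij}(\xi))}$ is smooth near $0$, and its Taylor series at $0$ is $\tilde\Theta(\xi)\sim1+\sum_{k\ge2}\mathcal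 H_k(\xi)$ with $\mathcal H_k$ homogeneous of degree $k$ and, for all $\xi\in T_PM$ (writing $\mathcal J_k$ for $\mathcal J_k(\xi)$, $\mathcal J=\mathcal J_0$), 1. $\mathcal H_2(\xi)=-\frac{\operatorname{Tr}\{\mathcal J\}}{6}$. 2. $\mathcal H_3(\xi)=-\frac{\operatorname{Tr}\{\mathcal J_1\}}{12}$. 3. $\mathcal H_4(\xi)=\frac{\operatorname{Tr}\{\mathcal J\}^2}{72}-\frac{\operatorname{Tr}\{\mathcal J^2\}}{180}-\frac{\operatorname{Tr}\{\mathcal J_2\}}{40}$. 4. $\mathcal H_5(\xi)=\frac{\operatorname{Tr}\{\mathcal J\}\operatorname{Tr}\{\mathcal J_1\}}{72}-\frac{\operatorname{Tr}\{\mathcal J\mathcal J_1\}}{180}-\frac{\operatorname{Tr}\{\mathcal J_3\}}{180}$. 5. $\mathcal H_6(\xi)=-\frac{\operatorname{Tr}\{\mathcal J\}^3}{1296}+\frac{\operatorname{Tr}\{\mathcal J\}\operatorname{Tr}\{\mathcal J^2\}}{1080}+\frac{\operatorname{Tr}\{\mathcal J\}\operatorname{Tr}\{\mathcal J_2\}}{240}-\frac{\operatorname{Tr}\{\mathcal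 J^3\}}{2835}-\frac{\operatorname{Tr}\{\mathcal J\mathcal J_2\}}{630}+\frac{\operatorname{Tr}\{\mathcal J_1\}^2}{288}-\frac{\operatorname{Tr}\{\mathcal J_1^2\}}{672}-\frac{\operatorname{Tr}\{\mathcal J_4\}}{1008}$. 6. $\mathcal H_7(\xi)=\frac{\operatorname{Tr}\{\mathcal J\}\operatorname{Tr}\{\mathcal J\mathcal J_1\}}{1080}-\frac{\operatorname{Tr}\{\mathcal J\}^2\operatorname{Tr}\{\mathcal J_1\}}{864}-\frac{\operatorname{Tr}\{\mathcal J_5\}}{6720}+\frac{\operatorname{Tr}\{\mathcal J\}\operatorname{Tr}\{\mathcal J_3\}}{1080}+\frac{\operatorname{Tr}\{\mathcal J^2\}\operatorname{Tr}\{\mathcal J_1\}}{2160}-\frac{\operatorname{Tr}\{\mathcal J^2\mathcal J_1\}}{1890}-\frac{\operatorname{Tr}\{\mathcal J\mathcal J_3\}}{3024}+\frac{\operatorname{Tr}\{\mathcal J_1\}\operatorname{Tr}\{\mathcal J_2\}}{480}-\frac{\operatorname{Tr}\{\mathcal J_1\mathcal J_2\}}{1120}$. 7. $\mathcal H_8(\xi)=\frac{\operatorname{Tr}\{\mathcal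 J\}^4}{31104}-\frac{\operatorname{Tr}\{\mathcal J\}^2\operatorname{Tr}\{\mathcal J^2\}}{12960}-\frac{\operatorname{Tr}\{\mathcal J\}^2\operatorname{Tr}\{\mathcal J_2\}}{2880}+\frac{\operatorname{Tr}\{\mathcal J\}\operatorname{Tr}\{\mathcal J^3\}}{17010}+\frac{\operatorname{Tr}\{\mathcal J\}\operatorname{Tr}\{\mathcal J\mathcal J_2\}}{3780}-\frac{\operatorname{Tr}\{\mathcal J_6\}}{51840}-\frac{\operatorname{Tr}\{\mathcal J\}\operatorname{Tr}\{\mathcal J_1\}^2}{1728}+\frac{\operatorname{Tr}\{\mathcal J\}\operatorname{Tr}\{\mathcal J_1^2\}}{4032}-\frac{\operatorname{Tr}\{\mathcal J_2^2\}}{7200}+\frac{\operatorname{Tr}\{\mathcal J\}\operatorname{Tr}\{\mathcal J_4\}}{6048}+\frac{\operatorname{Tr}\{\mathcal J^2\}\operatorname{Tr}\{\mathcal J_2\}}{7200}+\frac{\operatorname{Tr}\{\mathcal J^2\}^2}{64800}-\frac{\operatorname{Tr}\{\mathcal J^4\}}{37800}-\frac{17\operatorname{Tr}\{\mathcal J^2\mathcal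 J_2\}}{113400}+\frac{\operatorname{Tr}\{\mathcal J\mathcal J_1\}\operatorname{Tr}\{\mathcal J_1\}}{2160}-\frac{5\operatorname{Tr}\{\mathcal J\mathcal J_1^2\}}{18144}-\frac{\operatorname{Tr}\{\mathcal J\mathcal J_4\}}{18144}+\frac{\operatorname{Tr}\{\mathcal J_1\}\operatorname{Tr}\{\mathcal J_3\}}{2160}-\frac{\operatorname{Tr}\{\mathcal J_1\mathcal J_3\}}{5184}+\frac{\operatorname{Tr}\{\mathcal J_2\}^2}{3200}$. -/

import Mathlib

set_option maxSynthPendingDepth 3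

open scoped Manifold ContDiff Topology

noncomputable section

namespace RiemannianTaylor

variable {E : Type*} [NormedAddCommGroup E] [NormedSpace ℝ E]

/-! ### Tensor calculus of a metric on (an open part of) a vector space

A Riemannian metric in coordinates is a function `G : E → E →L[ℝ] E →L[ℝ] ℝ`. Nothing below uses a
basis: `u, v, w, z` are vectors with constant components in the coordinates. -/

/-- The Christoffel symbols of the first kind,
`(u, v, w) ↦ (∂_u G(v, w) + ∂_v G(u, w) - ∂_w G(u, v)) / 2`. -/
def christoffelFirst (G : E → E →L[ℝ] E →L[ℝ] ℝ) (y : E) : E →L[ℝ] E →L[ℝ] E →L[ℝ] ℝ :=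
  let F : (E →L[ℝ] E →L[ℝ] ℝ) →L[ℝ] E →L[ℝ] E →L[ℝ] ℝ :=
    (ContinuousLinearMap.flipₗᵢ ℝ E E ℝ).toContinuousLinearEquiv
  let D : E →L[ℝ] E →L[ℝ] E →L[ℝ] ℝ := fderiv ℝ G y
  let D₁ : E →L[ℝ] E →L[ℝ] E →L[ℝ] ℝ := D.flip
  let D₂ : E →L[ℝ] E →L[ℝ] E →L[ℝ] ℝ := F ∘L D₁
  (1 / 2 : ℝ) • (D + D₁ - D₂)

theorem christoffelFirst_apply (G : E → E →L[ℝ] E →L[ℝ] ℝ) (y u v w : E) :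
    christoffelFirst G y u v w =
      (fderiv ℝ G y u v w + fderiv ℝ G y v u w - fderiv ℝ G y w u v) / 2 := by
  simp [christoffelFirst]
  ring

/-- The Christoffel symbols of the second kind (the Levi-Civita connection in coordinates):
`Γ(u, v) = ∇_u v` for constant vectors `u, v`, obtained by raising the last index. -/
def christoffel (G : E → E →L[ℝ] E →L[ℝ] ℝ) (y : E) : E →L[ℝ] E →L[ℝ] E :=
  (ContinuousLinearMap.compL ℝ E (E →L[ℝ] ℝ) E (G y).inverse) ∘L christoffelFirst G y

theorem christoffel_apply (G : E → E →L[ℝ] E →L[ℝ] ℝ) (y u v : E) :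
    christoffel G y u v = (G y).inverse (christoffelFirst G y u v) := rfl

/-- The curvature operator `R(u, v) w = ∇_u ∇_v w - ∇_v ∇_u w` for constant vectors
`u, v, w` (so that `[u, v] = 0`). -/
def curvatureOperator (G : E → E →L[ℝ] E →L[ℝ] ℝ) (y u v w : E) : E :=
  fderiv ℝ (christoffel G) y u v w - fderiv ℝ (christoffel G) y v u w
    + christoffel G y u (christoffel G y v w) - christoffel G y v (christoffel G y u w)

/-- The covariant curvature tensor `R(v₀, v₁, v₂, v₃) = G(R(v₀, v₁) v₂, v₃)`. -/
def curvatureTensor (G : E → E →L[ℝ] E →L[ℝ] ℝ) (y : E) :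
    ContinuousMultilinearMap ℝ (fun _ : Fin 4 => E) ℝ where
  toMultilinearMap := MultilinearMap.mk'
    (fun v => G y (curvatureOperator G y (v 0) (v 1) (v 2)) (v 3))
    (by
      intro m i a b
      fin_cases i <;> simp [curvatureOperator] <;> ring)
    (by
      intro m i c a
      fin_cases i <;> simp [curvatureOperator] <;> ring)
  cont := by
    change Continuous fun v : Fin 4 → E =>
      G y (curvatureOperator G y (v 0) (v 1) (v 2)) (v 3)
    unfold curvatureOperator
    fun_prop

theorem curvatureTensor_apply (G : E → E →L[ℝ] E →L[ℝ] ℝ) (y : E) (v : Fin 4 → E) :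
    curvatureTensor G y v = G y (curvatureOperator G y (v 0) (v 1) (v 2)) (v 3) := rfl

/-- The covariant derivative `∇T` of a covariant tensor field `T` of rank `r`; the new slot is the
last one. See `covDeriv_apply` for the formula. -/
def covDeriv (G : E → E →L[ℝ] E →L[ℝ] ℝ) {r : ℕ}
    (T : E → ContinuousMultilinearMap ℝ (fun _ : Fin r => E) ℝ) (y : E) :
    ContinuousMultilinearMap ℝ (fun _ : Fin (r + 1) => E) ℝ :=
  ContinuousMultilinearMap.uncurryRight
    (fderiv ℝ T y - ∑ a : Fin r,
      ((T y).compContinuousLinearMapLRight.toContinuousLinearMap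
        (fun _ => ContinuousLinearMap.id ℝ E) a) ∘L christoffel G y).flipMultilinear

/-- `(∇T)(v₁, …, vᵣ; u) = ∂_u (T(v₁, …, vᵣ)) - ∑ₐ T(v₁, …, Γ(u, vₐ), …, vᵣ)`. -/
theorem covDeriv_apply (G : E → E →L[ℝ] E →L[ℝ] ℝ) {r : ℕ}
    (T : E → ContinuousMultilinearMap ℝ (fun _ : Fin r => E) ℝ) (y : E) (v : Fin r → E) (u : E) :
    covDeriv G T y (Fin.snoc v u : Fin (r + 1) → E) =
      fderiv ℝ T y u v - ∑ a : Fin r, T y (Function.update v a (christoffel G y u (v a))) := by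
  have key : ∀ a : Fin r, (fun i => (Function.update (fun _ => ContinuousLinearMap.id ℝ E) a
      (christoffel G y u) : Fin r → E →L[ℝ] E) i (v i))
      = Function.update v a (christoffel G y u (v a)) := by
    intro a
    funext i
    by_cases h : i = a
    · subst h; simp
    · simp [h]
  simp only [covDeriv, ContinuousMultilinearMap.uncurryRight_apply,
    ContinuousLinearMap.flipMultilinear_apply_apply, Fin.snoc_last, Fin.init_snoc,
    sub_apply,
    sum_apply,
    ContinuousLinearMap.comp_apply, ContinuousMultilinearMap.toContinuousLinearMap_apply,
    ContinuousMultilinearMap.compContinuousLinearMapLRight_apply,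
    ContinuousMultilinearMap.compContinuousLinearMap_apply, key]

/-- The iterated covariant derivative `∇ᵏR` of the curvature tensor: the first four slots are those
of `R`, the last `k` slots are the directions of differentiation. -/
def covDerivCurvature (G : E → E →L[ℝ] E →L[ℝ] ℝ) : (k : ℕ) →
    E → ContinuousMultilinearMap ℝ (fun _ : Fin (4 + k) => E) ℝ
  | 0 => curvatureTensor G
  | k + 1 => covDeriv G (covDerivCurvature G k)

/-- The bilinear form `(η, ζ) ↦ ∇ᵏR(η, ξ, ξ, ζ; ξ, …, ξ)`. -/
def jacobiForm (G : E → E →L[ℝ] E →L[ℝ] ℝ) (y : E) (k : ℕ) (ξ : E) : E →ₗ[ℝ] E →ₗ[ℝ] ℝ :=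
  LinearMap.mk₂ ℝ
    (fun η ζ => covDerivCurvature G k y
      (Function.update (Function.update (fun _ => ξ) (Fin.castAdd k 0) η) (Fin.castAdd k 3) ζ))
    (fun η η' ζ => by
      have h : (Fin.castAdd k 0 : Fin (4 + k)) ≠ Fin.castAdd k 3 := by simp [Fin.ext_iff]
      simp only [Function.update_comm h, ContinuousMultilinearMap.map_update_add])
    (fun c η ζ => by
      have h : (Fin.castAdd k 0 : Fin (4 + k)) ≠ Fin.castAdd k 3 := by simp [Fin.ext_iff]
      simp only [Function.update_comm h, ContinuousMultilinearMap.map_update_smul])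
    (fun η ζ ζ' => ContinuousMultilinearMap.map_update_add _ _ _ _ _)
    (fun c η ζ => ContinuousMultilinearMap.map_update_smul _ _ _ _ _)

/-! ### Riemannian manifolds

`M` is a manifold without boundary modelled on the finite-dimensional space `E`. In Mathlib the
tangent space `TangentSpace 𝓘(ℝ, E) P` is the vector space `E` itself, a vector being represented by
its components in the preferred chart `extChartAt 𝓘(ℝ, E) P` at `P`. -/

variable {M : Type*} [TopologicalSpace M] [ChartedSpace E M] [IsManifold 𝓘(ℝ, E) ∞ M]

/-- The metric in the coordinates given by the preferred chart at `x₀`, i.e. its pull-back under the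
inverse of that chart. -/
def metricInChart
    (g : Bundle.ContMDiffRiemannianMetric 𝓘(ℝ, E) ∞ E (fun x : M => TangentSpace 𝓘(ℝ, E) x))
    (x₀ : M) (y : E) : E →L[ℝ] E →L[ℝ] ℝ :=
  let D : E →L[ℝ] E := mfderiv 𝓘(ℝ, E) 𝓘(ℝ, E) (extChartAt 𝓘(ℝ, E) x₀).symm y
  let B : E →L[ℝ] E →L[ℝ] ℝ := g.inner ((extChartAt 𝓘(ℝ, E) x₀).symm y)
  B.bilinearComp D D

/-- A curve `γ` is a geodesic on the open set `s` of parameters if it is `C²` there (it is then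
automatically smooth) and satisfies `u'' + Γ(u', u') = 0` in every preferred chart, where `u` is its
coordinate expression. -/
def IsGeodesicOn
    (g : Bundle.ContMDiffRiemannianMetric 𝓘(ℝ, E) ∞ E (fun x : M => TangentSpace 𝓘(ℝ, E) x))
    (γ : ℝ → M) (s : Set ℝ) : Prop :=
  IsOpen s ∧ ContMDiffOn 𝓘(ℝ, ℝ) 𝓘(ℝ, E) 2 γ s ∧
    ∀ x₀ : M, ∀ t ∈ s, γ t ∈ (extChartAt 𝓘(ℝ, E) x₀).source →
      deriv (deriv (extChartAt 𝓘(ℝ, E) x₀ ∘ γ)) t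
        + christoffel (metricInChart g x₀) (extChartAt 𝓘(ℝ, E) x₀ (γ t))
            (deriv (extChartAt 𝓘(ℝ, E) x₀ ∘ γ) t) (deriv (extChartAt 𝓘(ℝ, E) x₀ ∘ γ) t) = 0

/-- `γ` is a geodesic defined on an open interval containing `[0, 1]`, starting at the point `P` with
initial velocity `ξ ∈ T_P M`. -/
def IsGeodesicFrom
    (g : Bundle.ContMDiffRiemannianMetric 𝓘(ℝ, E) ∞ E (fun x : M => TangentSpace 𝓘(ℝ, E) x))
    (P : M) (ξ : E) (γ : ℝ → M) : Prop :=
  (∃ a b : ℝ, a < 0 ∧ 1 < b ∧ IsGeodesicOn g γ (Set.Ioo a b)) ∧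
    γ 0 = P ∧ deriv (extChartAt 𝓘(ℝ, E) P ∘ γ) 0 = ξ

/-- The domain of `exp_P`: the tangent vectors at `P` whose geodesic is defined up to time `1`. -/
def expDomain
    (g : Bundle.ContMDiffRiemannianMetric 𝓘(ℝ, E) ∞ E (fun x : M => TangentSpace 𝓘(ℝ, E) x))
    (P : M) : Set E :=
  {ξ | ∃ γ : ℝ → M, IsGeodesicFrom g P ξ γ}

open Classical in
/-- The exponential map `exp_P : T_P M → M`, `ξ ↦ γ_ξ(1)` (with the value `P` outside of
`expDomain g P`). -/
def expMap
    (g : Bundle.ContMDiffRiemannianMetric 𝓘(ℝ, E) ∞ E (fun x : M => TangentSpace 𝓘(ℝ, E) x))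
    (P : M) (ξ : E) : M :=
  if h : ∃ γ : ℝ → M, IsGeodesicFrom g P ξ γ then h.choose 1 else P

/-- The components `g_ij(ξ)` of the metric in the normal coordinates at `P` determined by the basis
`e` of `T_P M`: `g_ij` is `g` evaluated on the images of `e i`, `e j` under the differential of
`exp_P` at `ξ`. -/
def normalMetric
    (g : Bundle.ContMDiffRiemannianMetric 𝓘(ℝ, E) ∞ E (fun x : M => TangentSpace 𝓘(ℝ, E) x))
    (P : M) {ι : Type*} (e : ι → E) (ξ : E) : Matrix ι ι ℝ :=
  let D : E →L[ℝ] TangentSpace 𝓘(ℝ, E) (expMap g P ξ) :=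
    mfderiv 𝓘(ℝ, E) 𝓘(ℝ, E) (expMap g P) ξ
  Matrix.of fun i j => g.inner (expMap g P ξ) (D (e i)) (D (e j))

/-- The volume density `√det(g_ij)` in normal coordinates at `P`, as a function on `T_P M`. -/
def volumeDensity
    (g : Bundle.ContMDiffRiemannianMetric 𝓘(ℝ, E) ∞ E (fun x : M => TangentSpace 𝓘(ℝ, E) x))
    (P : M) {ι : Type*} [Fintype ι] [DecidableEq ι] (e : ι → E) (ξ : E) : ℝ :=
  √(normalMetric g P e ξ).det

/-- The homogeneous part of degree `k` of the Taylor series at `0` of a smooth function. -/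
def taylorTerm (f : E → ℝ) (k : ℕ) (ξ : E) : ℝ :=
  (k.factorial : ℝ)⁻¹ * iteratedFDeriv ℝ k f 0 (fun _ => ξ)

variable [FiniteDimensional ℝ E]

/-- The metric at `P` as an isomorphism from `T_P M` to its dual. -/
def flat (g : Bundle.ContMDiffRiemannianMetric 𝓘(ℝ, E) ∞ E (fun x : M => TangentSpace 𝓘(ℝ, E) x))
    (P : M) : E ≃ₗ[ℝ] (E →ₗ[ℝ] ℝ) :=
  let B : E →L[ℝ] E →L[ℝ] ℝ := g.inner P
  LinearEquiv.ofInjectiveOfFinrankEq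
    ((LinearMap.toContinuousLinearMap (𝕜 := ℝ) (E := E) (F' := ℝ)).symm.toLinearMap ∘ₗ
      B.toLinearMap)
    (by
      rw [injective_iff_map_eq_zero]
      intro v hv
      by_contra hne
      have h1 : B v v = 0 := by simpa using LinearMap.congr_fun hv v
      exact (g.pos P v hne).ne' h1)
    (Subspace.dual_finrank_eq (K := ℝ) (V := E)).symm

/-- The operator `𝒥_k(ξ) = ∇_ξ^k 𝒥(ξ)` on `T_P M`, defined by
`g(𝒥_k(ξ) η, ζ) = ∇ᵏR(η, ξ, ξ, ζ; ξ, …, ξ)`; for `k = 0` this is the Jacobi operator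
`𝒥(ξ) η = R(η, ξ) ξ`. -/
def jacobiOperator
    (g : Bundle.ContMDiffRiemannianMetric 𝓘(ℝ, E) ∞ E (fun x : M => TangentSpace 𝓘(ℝ, E) x))
    (P : M) (k : ℕ) (ξ : E) : Module.End ℝ E :=
  (flat g P).symm.toLinearMap ∘ₗ jacobiForm (metricInChart g P) (extChartAt 𝓘(ℝ, E) P P) k ξ

/-- The defining relation of `𝒥_k(ξ)`. -/
theorem inner_jacobiOperator
    (g : Bundle.ContMDiffRiemannianMetric 𝓘(ℝ, E) ∞ E (fun x : M => TangentSpace 𝓘(ℝ, E) x))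
    (P : M) (k : ℕ) (ξ η ζ : E) :
    (g.inner P : E →L[ℝ] E →L[ℝ] ℝ) (jacobiOperator g P k ξ η) ζ =
      covDerivCurvature (metricInChart g P) k (extChartAt 𝓘(ℝ, E) P P)
        (Function.update (Function.update (fun _ => ξ) (Fin.castAdd k 0) η)
          (Fin.castAdd k 3) ζ) := by
  have h := LinearMap.congr_fun ((flat g P).apply_symm_apply
    (jacobiForm (metricInChart g P) (extChartAt 𝓘(ℝ, E) P P) k ξ η)) ζ
  exact h

end RiemannianTaylor

end

/-!
Put `A(t) = t a(t)`, where `a(t)` is the differential of `exp_P` at `t ξ` read in a parallel frame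
along the geodesic `t ↦ exp_P (t ξ)`. The derivatives of `exp_P` in the initial velocity are Jacobi
fields, so `A'' + R A = 0`, where `R(t)` is the Jacobi operator in the same frame; since the frame is
parallel, the derivatives of `R` at `0` are the operators `𝒥_k(ξ)`
(`IsMetricOn.exists_jacobi_matrix`). A parallel frame is isometric, so the volume density at `t ξ` is
`det (a t)`.

The logarithmic derivative `u = a' a⁻¹` satisfies the Riccati equation `t u' + 2 u + t u² + t R = 0`,
and `(det a)' = det a · Tr u`. Comparing Taylor coefficients (`exists_riccati_coeff`) gives two
recursions
`(n + 3) u_{n+1} = -(𝒥_n / n! + ∑ u_i u_{n-i})`, `(n + 1) d_{n+1} = ∑ d_i Tr u_{n-i}`,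
and solving them for `n ≤ 7`, with cyclic invariance of the trace, is a computation in a ring with a
trace (`density_coeff`).

The analytic input is the smooth exponential map. In a chart the geodesic equation is rewritten as a
fixed-point equation for the velocity in the Banach space `C([-1, 1], E)`, in which the nonlinearity
is a smooth superposition operator; the inverse function theorem there gives smooth dependence on
the initial velocity together with the linearised equation (`exists_exponential`). On the manifold,
the transformation law of the Christoffel symbols (`christoffel_transform`) shows that the resulting
curves are geodesics in every chart, and uniqueness of geodesics
(`IsGeodesicFrom.eq_of_mem_source`, which uses that `M` is Hausdorff) identifies `exp_P` near the
origin with the map constructed in the chart (`IsLocalExponential.expMap_eq`).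
-/

noncomputable section

namespace RiemannianTaylor

/-! ### Smoothness of superposition operators on spaces of continuous functions -/

section Superposition

universe u

variable {K : Type*} [TopologicalSpace K] [CompactSpace K]
  {E F : Type u} [NormedAddCommGroup E] [NormedSpace ℝ E] [NormedAddCommGroup F] [NormedSpace ℝ F]

/-- Pointwise application of a continuous family of linear maps to a continuous function, as a
bounded bilinear map. -/
def pointwiseApply : C(K, E →L[ℝ] F) →L[ℝ] C(K, E) →L[ℝ] C(K, F) :=
  LinearMap.mkContinuous₂
    (LinearMap.mk₂ ℝ (fun A h => ⟨fun t => A t (h t), by fun_prop⟩)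
      (fun _ _ _ => by ext; simp) (fun _ _ _ => by ext; simp)
      (fun _ _ _ => by ext; simp) (fun _ _ _ => by ext; simp))
    1 (by
      intro A h
      rw [ContinuousMap.norm_le _ (by positivity)]
      intro t
      calc ‖A t (h t)‖ ≤ ‖A t‖ * ‖h t‖ := (A t).le_opNorm _
        _ ≤ 1 * ‖A‖ * ‖h‖ := by
          rw [one_mul]
          gcongr
          · exact A.norm_coe_le_norm t
          · exact h.norm_coe_le_norm t)

@[simp]
theorem pointwiseApply_apply (A : C(K, E →L[ℝ] F)) (h : C(K, E)) (t : K) :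
    pointwiseApply A h t = A t (h t) := rfl

/-- The superposition operator `u ↦ f ∘ u` is differentiable if `f` is `C¹`: the remainder is
estimated uniformly by the mean value inequality, since `u ↦ f' ∘ u` is continuous. -/
theorem hasFDerivAt_comp_left (f : C(E, F)) (f' : C(E, E →L[ℝ] F))
    (hf : ∀ x, HasFDerivAt f (f' x) x) (u : C(K, E)) :
    HasFDerivAt (fun u : C(K, E) => f.comp u) (pointwiseApply (f'.comp u)) u := by
  rw [hasFDerivAt_iff_isLittleO_nhds_zero, Asymptotics.isLittleO_iff]
  intro ε hε
  have hc : Continuous fun w : C(K, E) => f'.comp w := ContinuousMap.continuous_postcomp f'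
  obtain ⟨δ, hδ, H⟩ := Metric.continuousAt_iff.1 hc.continuousAt ε hε
  filter_upwards [Metric.ball_mem_nhds (0 : C(K, E)) hδ] with h hh
  rw [ContinuousMap.norm_le _ (by positivity)]
  intro t
  have key : ∀ x ∈ segment ℝ (u t) (u t + h t), ‖f' x - f' (u t)‖ ≤ ε := by
    intro x hx
    rw [segment_eq_image'] at hx
    obtain ⟨s, hs, rfl⟩ := hx
    have h1 : dist (u + s • h) u < δ := by
      rw [dist_eq_norm, add_sub_cancel_left, norm_smul, Real.norm_of_nonneg hs.1]
      rw [mem_ball_zero_iff] at hh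
      calc s * ‖h‖ ≤ 1 * ‖h‖ := by gcongr; exact hs.2
        _ < δ := by rwa [one_mul]
    have h2 := H h1
    rw [dist_eq_norm] at h2
    have h3 := ((f'.comp (u + s • h) - f'.comp u).norm_coe_le_norm t).trans h2.le
    simpa using h3
  have h4 := Convex.norm_image_sub_le_of_norm_hasFDerivWithin_le' (f := f) (f' := f')
    (fun x _ => (hf x).hasFDerivWithinAt) key (convex_segment _ _)
    (left_mem_segment ℝ _ _) (right_mem_segment ℝ _ _)
  rw [add_sub_cancel_left] at h4
  calc _ ≤ ε * ‖h t‖ := h4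
    _ ≤ ε * ‖h‖ := by gcongr; exact h.norm_coe_le_norm t

theorem contDiff_comp_left_nat (n : ℕ) : ∀ {F : Type u} [NormedAddCommGroup F] [NormedSpace ℝ F]
    (f : C(E, F)), ContDiff ℝ n f → ContDiff ℝ n fun u : C(K, E) => f.comp u := by
  induction n with
  | zero =>
    intro F _ _ f _
    exact contDiff_zero.2 (ContinuousMap.continuous_postcomp f)
  | succ n ih =>
    intro F _ _ f hf
    have hf' : ContDiff ℝ n (fderiv ℝ f) := hf.fderiv_right le_rfl
    let f' : C(E, E →L[ℝ] F) := ⟨fderiv ℝ f, hf'.continuous⟩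
    let T : C(K, E →L[ℝ] F) →L[ℝ] C(K, E) →L[ℝ] C(K, F) := pointwiseApply
    refine contDiff_succ_iff_hasFDerivAt.2 ⟨fun u => T (f'.comp u),
      T.contDiff.comp (ih f' hf'), fun u => hasFDerivAt_comp_left f f' (fun x => ?_) u⟩
    exact (hf.differentiable (by simp) x).hasFDerivAt

/-- If `f` is smooth, then so is `u ↦ f ∘ u` on the Banach space `C(K, E)`. -/
theorem contDiff_comp_left (f : C(E, F)) (hf : ContDiff ℝ ∞ f) :
    ContDiff ℝ ∞ fun u : C(K, E) => f.comp u :=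
  contDiff_infty.2 fun n => contDiff_comp_left_nat n f (contDiff_infty.1 hf n)

end Superposition

/-! ### The flow of a second-order equation with quadratic velocity dependence -/

section Flow

universe u

variable {E : Type u} [NormedAddCommGroup E]

/-- The constant extension of a continuous function on `[-1, 1]` to the real line. -/
def extendTime (v : C(Set.Icc (-1 : ℝ) 1, E)) (t : ℝ) : E :=
  v (Set.projIcc (-1) 1 (by norm_num) t)

theorem continuous_extendTime (v : C(Set.Icc (-1 : ℝ) 1, E)) : Continuous (extendTime v) :=
  v.continuous.comp continuous_projIcc

theorem extendTime_of_mem (v : C(Set.Icc (-1 : ℝ) 1, E)) {t : ℝ} (ht : t ∈ Set.Icc (-1 : ℝ) 1) :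
    extendTime v t = v ⟨t, ht⟩ := by
  rw [extendTime, Set.projIcc_of_mem _ ht]

theorem norm_extendTime_le (v : C(Set.Icc (-1 : ℝ) 1, E)) (t : ℝ) : ‖extendTime v t‖ ≤ ‖v‖ :=
  v.norm_coe_le_norm _

variable [NormedSpace ℝ E]

/-- The primitive `t ↦ ∫₀ᵗ v` of a continuous function on `[-1, 1]`, as a bounded operator. -/
def primitive : C(Set.Icc (-1 : ℝ) 1, E) →L[ℝ] C(Set.Icc (-1 : ℝ) 1, E) :=
  LinearMap.mkContinuous
    { toFun := fun v => ⟨fun t => ∫ s in (0 : ℝ)..t, extendTime v s,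
        (intervalIntegral.continuous_primitive
          (fun a b => (continuous_extendTime v).intervalIntegrable a b) 0).comp
          continuous_subtype_val⟩
      map_add' := fun v w => by
        ext t
        exact intervalIntegral.integral_add ((continuous_extendTime v).intervalIntegrable _ _)
          ((continuous_extendTime w).intervalIntegrable _ _)
      map_smul' := fun c v => by
        ext t
        exact intervalIntegral.integral_smul c _ }
    1 (by
      intro v
      rw [ContinuousMap.norm_le _ (by positivity)]
      intro t
      have h := intervalIntegral.norm_integral_le_of_norm_le_const (a := 0) (b := (t : ℝ))
        (fun x _ => norm_extendTime_le v x)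
      have ht : |(t : ℝ) - 0| ≤ 1 := by rw [sub_zero]; exact abs_le.2 t.2
      calc _ ≤ ‖v‖ * |(t : ℝ) - 0| := h
        _ ≤ ‖v‖ * 1 := by gcongr
        _ = 1 * ‖v‖ := mul_comm _ _)

theorem primitive_apply (v : C(Set.Icc (-1 : ℝ) 1, E)) (t : Set.Icc (-1 : ℝ) 1) :
    primitive v t = ∫ s in (0 : ℝ)..t, extendTime v s := rfl

theorem hasDerivAt_primitive [CompleteSpace E] (v : C(Set.Icc (-1 : ℝ) 1, E)) {t : ℝ}
    (ht : t ∈ Set.Ioo (-1 : ℝ) 1) :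
    HasDerivAt (extendTime (primitive v)) (extendTime v t) t := by
  have h := intervalIntegral.integral_hasDerivAt_right
    ((continuous_extendTime v).intervalIntegrable 0 t)
    ((continuous_extendTime v).stronglyMeasurableAtFilter _ _) (continuous_extendTime v).continuousAt
  refine h.congr_of_eventuallyEq ?_
  filter_upwards [Icc_mem_nhds ht.1 ht.2] with s hs
  rw [extendTime_of_mem _ hs, primitive_apply]

/-- The constant functions, as a bounded operator. -/
def constCLM : E →L[ℝ] C(Set.Icc (-1 : ℝ) 1, E) :=
  LinearMap.mkContinuous
    { toFun := fun ξ => ContinuousMap.const _ ξ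
      map_add' := fun _ _ => rfl
      map_smul' := fun _ _ => rfl }
    1 (by
      intro ξ
      rw [ContinuousMap.norm_le _ (by positivity)]
      intro t
      exact (one_mul ‖ξ‖).ge)

@[simp]
theorem constCLM_apply (ξ : E) (t : Set.Icc (-1 : ℝ) 1) : constCLM ξ t = ξ := rfl

/-- The map `v ↦ (∫₀ᵗ v, v)` from velocities to (position, velocity) pairs. -/
def primitivePair : C(Set.Icc (-1 : ℝ) 1, E) →L[ℝ] C(Set.Icc (-1 : ℝ) 1, E × E) :=
  ((ContinuousLinearMap.inl ℝ E E).compLeftContinuous ℝ _) ∘L primitive +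
    (ContinuousLinearMap.inr ℝ E E).compLeftContinuous ℝ _

@[simp]
theorem primitivePair_apply (v : C(Set.Icc (-1 : ℝ) 1, E)) (t : Set.Icc (-1 : ℝ) 1) :
    primitivePair v t = (primitive v t, v t) := by
  simp [primitivePair]

/-- The operator `v ↦ v + ∫₀ᵗ q(p + ∫₀ˢ v, v) ds`. The equation `velocityOperator q p v = ξ` says
that `u = p + ∫ v` solves `u'' + q(u, u') = 0`, `u(0) = p`, `u'(0) = ξ`. -/
def velocityOperator (q : C(E × E, E)) (p : E) (v : C(Set.Icc (-1 : ℝ) 1, E)) :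
    C(Set.Icc (-1 : ℝ) 1, E) :=
  v + primitive (q.comp (primitivePair v + ContinuousMap.const _ (p, 0)))

theorem contDiff_velocityOperator (q : C(E × E, E)) (hq : ContDiff ℝ ∞ q) (p : E) :
    ContDiff ℝ ∞ (velocityOperator q p) := by
  let A : C(Set.Icc (-1 : ℝ) 1, E) →L[ℝ] C(Set.Icc (-1 : ℝ) 1, E × E) := primitivePair
  let V : C(Set.Icc (-1 : ℝ) 1, E) →L[ℝ] C(Set.Icc (-1 : ℝ) 1, E) := primitive
  have h1 : ContDiff ℝ ∞ fun v => A v + ContinuousMap.const _ (p, (0 : E)) :=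
    A.contDiff.add contDiff_const
  exact contDiff_id.add (V.contDiff.comp ((contDiff_comp_left q hq).comp h1))

theorem hasFDerivAt_velocityOperator (q : C(E × E, E)) (q' : C(E × E, E × E →L[ℝ] E))
    (hq : ∀ x, HasFDerivAt q (q' x) x) (p : E) (v : C(Set.Icc (-1 : ℝ) 1, E)) :
    HasFDerivAt (velocityOperator q p)
      (ContinuousLinearMap.id ℝ _ + primitive ∘L
        (pointwiseApply (q'.comp (primitivePair v + ContinuousMap.const _ (p, 0)))) ∘L
          primitivePair) v := by
  let A : C(Set.Icc (-1 : ℝ) 1, E) →L[ℝ] C(Set.Icc (-1 : ℝ) 1, E × E) := primitivePair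
  let V : C(Set.Icc (-1 : ℝ) 1, E) →L[ℝ] C(Set.Icc (-1 : ℝ) 1, E) := primitive
  have h1 : HasFDerivAt (fun v => A v + ContinuousMap.const _ (p, (0 : E))) A v :=
    A.hasFDerivAt.add_const _
  have h2 := (hasFDerivAt_comp_left q q' hq (A v + ContinuousMap.const _ (p, (0 : E)))).comp v h1
  exact (hasFDerivAt_id v).add (HasFDerivAt.comp (g := V) v V.hasFDerivAt h2)

/-- A solution of the integral equation solves the differential equation. -/
theorem hasDerivAt_of_velocityOperator_eq [CompleteSpace E] {q : C(E × E, E)} {p ξ : E}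
    {v : C(Set.Icc (-1 : ℝ) 1, E)} (hv : velocityOperator q p v = constCLM ξ) {t : ℝ}
    (ht : t ∈ Set.Ioo (-1 : ℝ) 1) :
    HasDerivAt (extendTime v) (-q (p + extendTime (primitive v) t, extendTime v t)) t := by
  set w : C(Set.Icc (-1 : ℝ) 1, E) := q.comp (primitivePair v + ContinuousMap.const _ (p, 0))
    with hw
  have h0 : v = constCLM ξ - primitive w := by
    rw [← hv, velocityOperator, ← hw, add_sub_cancel_right]
  have h1 : extendTime v = fun s => ξ - extendTime (primitive w) s := by
    funext s
    rw [h0]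
    rfl
  have h2 : extendTime w t = q (p + extendTime (primitive v) t, extendTime v t) := by
    simp [hw, extendTime, add_comm]
  rw [← h2, h1]
  exact (hasDerivAt_primitive w ht).const_sub ξ

/-- A solution of the linearised integral equation solves the linearised differential equation. -/
theorem hasDerivAt_of_linearised_eq [CompleteSpace E] {q' : C(E × E, E × E →L[ℝ] E)} {p η : E}
    {v w : C(Set.Icc (-1 : ℝ) 1, E)}
    (hw : w + primitive (pointwiseApply
      (q'.comp (primitivePair v + ContinuousMap.const _ (p, 0))) (primitivePair w)) = constCLM η)
    {t : ℝ} (ht : t ∈ Set.Ioo (-1 : ℝ) 1) :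
    HasDerivAt (extendTime w) (-q' (p + extendTime (primitive v) t, extendTime v t)
      (extendTime (primitive w) t, extendTime w t)) t := by
  set z : C(Set.Icc (-1 : ℝ) 1, E) := pointwiseApply
      (q'.comp (primitivePair v + ContinuousMap.const _ (p, 0))) (primitivePair w) with hz
  have h0 : w = constCLM η - primitive z := by
    rw [← hw, add_sub_cancel_right]
  have h1 : extendTime w = fun s => η - extendTime (primitive z) s := by
    funext s
    rw [h0]
    rfl
  have h2 : extendTime z t = q' (p + extendTime (primitive v) t, extendTime v t)
      (extendTime (primitive w) t, extendTime w t) := by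
    simp [hz, extendTime, add_comm]
  rw [← h2, h1]
  exact (hasDerivAt_primitive z ht).const_sub η

/-- The rescaled function `t ↦ s • v(s t)`. -/
def rescale (v : C(Set.Icc (-1 : ℝ) 1, E)) (s : ℝ) : C(Set.Icc (-1 : ℝ) 1, E) :=
  ⟨fun t => s • extendTime v (s * t), by
    have := continuous_extendTime v
    fun_prop⟩

theorem norm_rescale_le (v : C(Set.Icc (-1 : ℝ) 1, E)) {s : ℝ} (hs : |s| ≤ 1) :
    ‖rescale v s‖ ≤ ‖v‖ := by
  rw [ContinuousMap.norm_le _ (norm_nonneg _)]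
  intro t
  change ‖s • extendTime v (s * t)‖ ≤ ‖v‖
  rw [norm_smul, Real.norm_eq_abs]
  calc |s| * ‖extendTime v (s * t)‖ ≤ 1 * ‖v‖ := by
        gcongr
        exact norm_extendTime_le v _
    _ = ‖v‖ := one_mul _

theorem mul_mem_Icc_of_abs_le_one {s t : ℝ} (hs : |s| ≤ 1) (ht : t ∈ Set.Icc (-1 : ℝ) 1) :
    s * t ∈ Set.Icc (-1 : ℝ) 1 := by
  rw [Set.mem_Icc, ← abs_le, abs_mul]
  exact mul_le_one₀ hs (abs_nonneg _) (abs_le.2 ht)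

theorem primitive_rescale (v : C(Set.Icc (-1 : ℝ) 1, E)) {s : ℝ} (hs : |s| ≤ 1)
    (t : Set.Icc (-1 : ℝ) 1) :
    primitive (rescale v s) t = extendTime (primitive v) (s * t) := by
  have h1 : ∀ r ∈ Set.uIcc (0 : ℝ) t, extendTime (rescale v s) r = s • extendTime v (s * r) := by
    intro r hr
    have hr' : r ∈ Set.Icc (-1 : ℝ) 1 :=
      (Set.uIcc_subset_Icc (by simp) t.2) hr
    rw [extendTime_of_mem _ hr']
    rfl
  rw [primitive_apply, intervalIntegral.integral_congr h1, intervalIntegral.integral_smul,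
    intervalIntegral.smul_integral_comp_mul_left, mul_zero,
    extendTime_of_mem _ (mul_mem_Icc_of_abs_le_one hs t.2), primitive_apply]

/-- If `q` is quadratic in the velocity, then rescaling time maps solutions to solutions. -/
theorem velocityOperator_rescale {q : C(E × E, E)}
    (hom : ∀ (s : ℝ) (x v : E), q (x, s • v) = s ^ 2 • q (x, v)) {p ξ : E}
    {v : C(Set.Icc (-1 : ℝ) 1, E)} (hv : velocityOperator q p v = constCLM ξ) {s : ℝ}
    (hs : |s| ≤ 1) : velocityOperator q p (rescale v s) = constCLM (s • ξ) := by
  set w : C(Set.Icc (-1 : ℝ) 1, E) := q.comp (primitivePair v + ContinuousMap.const _ (p, 0))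
    with hw
  have h1 : q.comp (primitivePair (rescale v s) + ContinuousMap.const _ (p, 0)) =
      s • rescale w s := by
    ext t
    have hst := mul_mem_Icc_of_abs_le_one hs t.2
    have : rescale v s t = s • extendTime v (s * t) := rfl
    have h' : rescale w s t = s • extendTime w (s * t) := rfl
    rw [ContinuousMap.smul_apply, h', extendTime_of_mem _ hst, hw]
    simp [this, primitive_rescale v hs, hom, extendTime_of_mem _ hst, smul_smul, pow_two]
  have h2 : velocityOperator q p v = v + primitive w := rfl
  ext t
  have hst := mul_mem_Icc_of_abs_le_one hs t.2
  have h3 := DFunLike.congr_fun (h2.symm.trans hv) ⟨s * t, hst⟩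
  rw [velocityOperator, h1, map_smul]
  have h4 : rescale v s t = s • v ⟨s * t, hst⟩ := by
    rw [← extendTime_of_mem v hst]; rfl
  simp only [ContinuousMap.add_apply, ContinuousMap.smul_apply, primitive_rescale w hs,
    extendTime_of_mem _ hst, h4, constCLM_apply] at h3 ⊢
  rw [← smul_add, h3]

variable [CompleteSpace E]

/-- The integral equation can be solved for small initial velocities, by the inverse function
theorem at the zero solution, and the solution depends smoothly on the initial velocity. -/
theorem exists_velocity_family (q : C(E × E, E)) (hq : ContDiff ℝ ∞ q) (p : E)
    (hq0 : q (p, 0) = 0) (hq1 : fderiv ℝ q (p, 0) = 0)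
    (hom : ∀ (s : ℝ) (x v : E), q (x, s • v) = s ^ 2 • q (x, v)) :
    ∃ r > 0, ∃ v : E → C(Set.Icc (-1 : ℝ) 1, E), ContDiffOn ℝ ∞ v (Metric.ball 0 r) ∧
      v 0 = 0 ∧ HasFDerivAt v constCLM 0 ∧
      (∀ ξ ∈ Metric.ball (0 : E) r, velocityOperator q p (v ξ) = constCLM ξ) ∧
      ∀ ξ ∈ Metric.ball (0 : E) r, ∀ s : ℝ, |s| ≤ 1 → v (s • ξ) = rescale (v ξ) s := by
  set Φ := velocityOperator q p with hΦ
  have hs : ContDiff ℝ ∞ Φ := contDiff_velocityOperator q hq p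
  let q' : C(E × E, E × E →L[ℝ] E) := ⟨fderiv ℝ q, hq.continuous_fderiv (by simp)⟩
  have hq' : ∀ x, HasFDerivAt q (q' x) x := fun x => (hq.differentiable (by simp) x).hasFDerivAt
  have hΦ0 : Φ 0 = 0 := by
    have : q.comp (primitivePair (0 : C(Set.Icc (-1 : ℝ) 1, E)) + ContinuousMap.const _ (p, 0)) =
        0 := by
      ext t
      simp [hq0]
    rw [hΦ, velocityOperator, this]
    simp
  have hD0 : HasFDerivAt Φ
      ((ContinuousLinearEquiv.refl ℝ C(Set.Icc (-1 : ℝ) 1, E) :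
        C(Set.Icc (-1 : ℝ) 1, E) ≃L[ℝ] C(Set.Icc (-1 : ℝ) 1, E)) :
        C(Set.Icc (-1 : ℝ) 1, E) →L[ℝ] C(Set.Icc (-1 : ℝ) 1, E)) 0 := by
    have h := hasFDerivAt_velocityOperator q q' hq' p 0
    have h0 : q'.comp (primitivePair (0 : C(Set.Icc (-1 : ℝ) 1, E)) +
        ContinuousMap.const _ (p, 0)) = 0 := by
      ext1 t
      simp [q', hq1]
    rw [h0, map_zero] at h
    simpa using! h
  have hs0 : ContDiffAt ℝ ∞ Φ 0 := hs.contDiffAt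
  let e := hs0.toOpenPartialHomeomorph Φ hD0 (by simp)
  have he : (e : C(Set.Icc (-1 : ℝ) 1, E) → C(Set.Icc (-1 : ℝ) 1, E)) = Φ := rfl
  have he0 : (0 : C(Set.Icc (-1 : ℝ) 1, E)) ∈ e.source :=
    hs0.mem_toOpenPartialHomeomorph_source hD0 (by simp)
  have ht0 : (0 : C(Set.Icc (-1 : ℝ) 1, E)) ∈ e.target := by
    have := e.map_source he0
    rwa [he, hΦ0] at this
  have hsymm0 : e.symm 0 = 0 := by
    have := e.left_inv he0
    rwa [he, hΦ0] at this
  obtain ⟨δ, hδ, hδs⟩ := Metric.mem_nhds_iff.1 (e.open_source.mem_nhds he0)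
  have hinv : ∀ᶠ w in 𝓝 (0 : C(Set.Icc (-1 : ℝ) 1, E)),
      ∃ L : C(Set.Icc (-1 : ℝ) 1, E) ≃L[ℝ] C(Set.Icc (-1 : ℝ) 1, E),
        (L : C(Set.Icc (-1 : ℝ) 1, E) →L[ℝ] C(Set.Icc (-1 : ℝ) 1, E)) = fderiv ℝ Φ w := by
    have hc : ContinuousAt (fderiv ℝ Φ) 0 := (hs.continuous_fderiv (by simp)).continuousAt
    have hn := ContinuousLinearEquiv.nhds (ContinuousLinearEquiv.refl ℝ C(Set.Icc (-1 : ℝ) 1, E))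
    rw [← hD0.fderiv] at hn
    exact hc.eventually hn
  have hcs : ContinuousAt e.symm 0 := e.symm.continuousAt ht0
  have hgood : ∀ᶠ y in 𝓝 (0 : C(Set.Icc (-1 : ℝ) 1, E)), y ∈ e.target ∧
      e.symm y ∈ Metric.ball (0 : C(Set.Icc (-1 : ℝ) 1, E)) δ ∧
      ∃ L : C(Set.Icc (-1 : ℝ) 1, E) ≃L[ℝ] C(Set.Icc (-1 : ℝ) 1, E),
        (L : C(Set.Icc (-1 : ℝ) 1, E) →L[ℝ] C(Set.Icc (-1 : ℝ) 1, E)) =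
          fderiv ℝ Φ (e.symm y) := by
    have h1 : ∀ᶠ w in 𝓝 (e.symm 0), w ∈ Metric.ball (0 : C(Set.Icc (-1 : ℝ) 1, E)) δ := by
      rw [hsymm0]
      exact Metric.ball_mem_nhds _ hδ
    rw [← hsymm0] at hinv
    filter_upwards [e.open_target.mem_nhds ht0, hcs.eventually h1, hcs.eventually hinv]
      with y hy1 hy2 hy3 using ⟨hy1, hy2, hy3⟩
  let C : E →L[ℝ] C(Set.Icc (-1 : ℝ) 1, E) := constCLM
  have hC : Filter.Tendsto C (𝓝 0) (𝓝 0) := by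
    simpa using C.continuous.tendsto 0
  obtain ⟨r, hr, hball⟩ := Metric.eventually_nhds_iff_ball.1 (hC.eventually hgood)
  refine ⟨r, hr, fun ξ => e.symm (C ξ), ?_, ?_, ?_, ?_, ?_⟩
  · intro ξ hξ
    obtain ⟨h1, h2, L, hL⟩ := hball ξ hξ
    refine ContDiffAt.contDiffWithinAt (ContDiffAt.comp (g := e.symm) ξ ?_ C.contDiff.contDiffAt)
    refine e.contDiffAt_symm h1 (f₀' := L) ?_ hs.contDiffAt
    rw [hL]
    exact (hs.differentiable (by simp) _).hasFDerivAt
  · simp [hsymm0]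
  · have hd : HasFDerivAt e.symm (ContinuousLinearMap.id ℝ C(Set.Icc (-1 : ℝ) 1, E)) (C 0) := by
      rw [map_zero]
      have hD0' := hD0
      rw [← hsymm0, ← he] at hD0'
      exact e.hasFDerivAt_symm ht0 hD0'
    exact hd.comp (0 : E) C.hasFDerivAt
  · intro ξ hξ
    exact e.right_inv (hball ξ hξ).1
  · intro ξ hξ s hs1
    obtain ⟨h1, h2, -⟩ := hball ξ hξ
    have h3 : Φ (e.symm (C ξ)) = constCLM ξ := e.right_inv h1
    have h4 : rescale (e.symm (C ξ)) s ∈ e.source := by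
      refine hδs (mem_ball_zero_iff.2 ?_)
      exact (norm_rescale_le _ hs1).trans_lt (mem_ball_zero_iff.1 h2)
    have h5 := e.left_inv h4
    rw [he, hΦ, velocityOperator_rescale hom h3 hs1] at h5
    exact h5

/-- **The exponential map of a second-order equation** `u'' + Q(u)(u', u') = 0` at a point `p`.
There is a smooth map `F` near `0` with `F 0 = p` and `F'(0) = id` whose radial curves
`t ↦ F(t ξ)` solve the equation with initial velocity `ξ`; moreover `t ↦ t • F'(t ξ) η` solves the
linearised equation. -/
theorem exists_exponential (Q : E → E →L[ℝ] E →L[ℝ] E) (hQ : ContDiff ℝ ∞ Q) (p : E) :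
    ∃ F : E → E, ∃ r > 0, F 0 = p ∧ HasFDerivAt F (ContinuousLinearMap.id ℝ E) 0 ∧
      ContDiffOn ℝ ∞ F (Metric.ball 0 r) ∧
      ∀ (ξ : E) (l : ℝ), 0 < l → l • ξ ∈ Metric.ball (0 : E) r →
        ∃ v : ℝ → E, (∀ t, |t| < l → HasDerivAt (fun s => F (s • ξ)) (v t) t ∧
          HasDerivAt v (-Q (F (t • ξ)) (v t) (v t)) t) ∧
        ∀ η : E, ∃ w : ℝ → E, ∀ t, |t| < l →
          HasDerivAt (fun s => s • fderiv ℝ F (s • ξ) η) (w t) t ∧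
          HasDerivAt w (-(fderiv ℝ Q (F (t • ξ)) (t • fderiv ℝ F (t • ξ) η) (v t) (v t)
            + Q (F (t • ξ)) (w t) (v t) + Q (F (t • ξ)) (v t) (w t))) t := by
  have hqs : ContDiff ℝ ∞ fun x : E × E => Q x.1 x.2 x.2 :=
    ((hQ.comp contDiff_fst).clm_apply contDiff_snd).clm_apply contDiff_snd
  let q : C(E × E, E) := ⟨fun x => Q x.1 x.2 x.2, hqs.continuous⟩
  let q' : C(E × E, E × E →L[ℝ] E) := ⟨fderiv ℝ q, hqs.continuous_fderiv (by simp)⟩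
  have hq' : ∀ x, HasFDerivAt q (q' x) x := fun x => (hqs.differentiable (by simp) x).hasFDerivAt
  have hq'_apply : ∀ x v a b : E, q' (x, v) (a, b) = fderiv ℝ Q x a v v + Q x b v + Q x v b := by
    intro x v a b
    have h1 : HasFDerivAt Q (fderiv ℝ Q x) x := (hQ.differentiable (by simp) x).hasFDerivAt
    have h2 : HasFDerivAt (fun y : E × E => Q y.1) (fderiv ℝ Q x ∘L ContinuousLinearMap.fst ℝ E E)
        (x, v) := HasFDerivAt.comp (g := Q) (x, v) h1 hasFDerivAt_fst
    have h3 := (h2.clm_apply (hasFDerivAt_snd (𝕜 := ℝ) (p := (x, v)))).clm_apply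
      (hasFDerivAt_snd (𝕜 := ℝ) (p := (x, v)))
    rw [(hq' (x, v)).unique h3]
    simp
    abel
  have hom : ∀ (s : ℝ) (x v : E), q (x, s • v) = s ^ 2 • q (x, v) := by
    intro s x v
    simp [q, pow_two, smul_smul]
  obtain ⟨r, hr, v, hv, hv0, hv1, hveq, hvs⟩ := exists_velocity_family q hqs p (by simp [q])
    (by
      refine ContinuousLinearMap.ext fun x => ?_
      change q' (p, 0) (x.1, x.2) = 0
      simp [hq'_apply]) hom
  let V : C(Set.Icc (-1 : ℝ) 1, E) →L[ℝ] C(Set.Icc (-1 : ℝ) 1, E) := primitive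
  have h1mem : (1 : ℝ) ∈ Set.Icc (-1 : ℝ) 1 := by simp
  let ev : C(Set.Icc (-1 : ℝ) 1, E) →L[ℝ] E :=
    (ContinuousMap.evalCLM ℝ (⟨1, h1mem⟩ : Set.Icc (-1 : ℝ) 1)) ∘L V
  let F : E → E := fun ξ => p + ev (v ξ)
  have hvd : ∀ ξ ∈ Metric.ball (0 : E) r, HasFDerivAt v (fderiv ℝ v ξ) ξ := fun ξ hξ =>
    ((hv.contDiffAt (Metric.isOpen_ball.mem_nhds hξ)).differentiableAt (by simp)).hasFDerivAt
  have hFd : ∀ ξ ∈ Metric.ball (0 : E) r, HasFDerivAt F (ev ∘L fderiv ℝ v ξ) ξ := fun ξ hξ =>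
    (HasFDerivAt.comp (g := ev) ξ ev.hasFDerivAt (hvd ξ hξ)).const_add p
  -- the radial curves of `F` are the solutions of the integral equation
  have hrad : ∀ ξ ∈ Metric.ball (0 : E) r, ∀ s : ℝ, |s| ≤ 1 →
      F (s • ξ) = p + extendTime (V (v ξ)) s := by
    intro ξ hξ s hs
    have : ev (v (s • ξ)) = extendTime (V (v ξ)) s := by
      rw [hvs ξ hξ s hs]
      simpa using! primitive_rescale (v ξ) hs ⟨1, h1mem⟩
    simp [F, this]
  have hradd : ∀ ξ ∈ Metric.ball (0 : E) r, ∀ (η : E) (s : ℝ), |s| ≤ 1 →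
      s • fderiv ℝ F (s • ξ) η = extendTime (V (fderiv ℝ v ξ η)) s := by
    intro ξ hξ η s hs
    have hsξ : s • ξ ∈ Metric.ball (0 : E) r := by
      rw [mem_ball_zero_iff, norm_smul, Real.norm_eq_abs] at *
      exact (mul_le_of_le_one_left (norm_nonneg _) hs).trans_lt hξ
    have hsm : s ∈ Set.Icc (-1 : ℝ) 1 := abs_le.1 hs
    let evs : C(Set.Icc (-1 : ℝ) 1, E) →L[ℝ] E :=
      (ContinuousMap.evalCLM ℝ (⟨s, hsm⟩ : Set.Icc (-1 : ℝ) 1)) ∘L V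
    have h1 : HasFDerivAt (fun ξ => F (s • ξ)) (evs ∘L fderiv ℝ v ξ) ξ := by
      have := (HasFDerivAt.comp (g := evs) ξ evs.hasFDerivAt (hvd ξ hξ)).const_add p
      refine this.congr_of_eventuallyEq ?_
      filter_upwards [Metric.isOpen_ball.mem_nhds hξ] with ζ hζ
      rw [hrad ζ hζ s hs, extendTime_of_mem _ hsm]
      rfl
    have h2 : HasFDerivAt (fun ξ => F (s • ξ))
        (fderiv ℝ F (s • ξ) ∘L (s • ContinuousLinearMap.id ℝ E)) ξ := by
      rw [(hFd _ hsξ).fderiv]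
      exact HasFDerivAt.comp (g := F) ξ (hFd _ hsξ) ((hasFDerivAt_id ξ).const_smul s)
    have h3 := congrArg (fun L : E →L[ℝ] E => L η) (h2.unique h1)
    rw [extendTime_of_mem _ hsm]
    simpa using! h3
  refine ⟨F, r, hr, ?_, ?_, ?_, ?_⟩
  · simp [F, hv0]
  · have h := (HasFDerivAt.comp (g := ev) (0 : E) ev.hasFDerivAt hv1).const_add p
    refine h.congr_fderiv ?_
    ext ξ
    change primitive (constCLM ξ) ⟨1, h1mem⟩ = ξ
    rw [primitive_apply]
    simp [extendTime]
  · exact contDiffOn_const.add (ev.contDiff.comp_contDiffOn hv)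
  · intro ξ l hl hξ
    have hscale : ∀ t : ℝ, (t / l) • l • ξ = t • ξ := by
      intro t
      rw [smul_smul, div_mul_cancel₀ _ hl.ne']
    have habs : ∀ t : ℝ, |t| < l → t / l ∈ Set.Ioo (-1 : ℝ) 1 := by
      intro t ht
      rw [Set.mem_Ioo, ← abs_lt, abs_div, abs_of_pos hl, div_lt_one hl]
      exact ht
    have hdiv : ∀ t : ℝ, HasDerivAt (fun s : ℝ => s / l) l⁻¹ t := fun t => by
      simpa using (hasDerivAt_id t).div_const l
    have hnear : ∀ t : ℝ, |t| < l → ∀ᶠ s in 𝓝 t, |s| < l := fun t ht =>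
      (isOpen_lt continuous_abs continuous_const).mem_nhds ht
    have hF : ∀ t : ℝ, |t| < l → F (t • ξ) = p + extendTime (V (v (l • ξ))) (t / l) := by
      intro t ht
      rw [← hscale, hrad _ hξ _ (abs_le.2 ⟨(habs t ht).1.le, (habs t ht).2.le⟩)]
    refine ⟨fun t => l⁻¹ • extendTime (v (l • ξ)) (t / l), ?_, ?_⟩
    · intro t ht
      constructor
      · have h1 := ((hasDerivAt_primitive (v (l • ξ)) (habs t ht)).scomp t (hdiv t)).const_add p
        refine h1.congr_of_eventuallyEq ?_
        filter_upwards [hnear t ht] with s hs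
        rw [hF s hs]
        rfl
      · have h1 := ((hasDerivAt_of_velocityOperator_eq (hveq _ hξ) (habs t ht)).scomp t
          (hdiv t)).const_smul l⁻¹
        convert! h1 using 1
        rw [hF t ht]
        simp [q, V]
    · intro η
      have hfd : ∀ t : ℝ, |t| < l → t • fderiv ℝ F (t • ξ) η =
          extendTime (V (fderiv ℝ v (l • ξ) (l • η))) (t / l) := by
        intro t ht
        rw [← hradd _ hξ (l • η) _ (abs_le.2 ⟨(habs t ht).1.le, (habs t ht).2.le⟩), hscale,
          map_smul, smul_smul, div_mul_cancel₀ _ hl.ne']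
      have hlin : fderiv ℝ v (l • ξ) (l • η) + primitive (pointwiseApply
          (q'.comp (primitivePair (v (l • ξ)) + ContinuousMap.const _ (p, 0)))
          (primitivePair (fderiv ℝ v (l • ξ) (l • η)))) = constCLM (l • η) := by
        have h1 := HasFDerivAt.comp (l • ξ) (hasFDerivAt_velocityOperator q q' hq' p (v (l • ξ)))
          (hvd _ hξ)
        let C : E →L[ℝ] C(Set.Icc (-1 : ℝ) 1, E) := constCLM
        have h2 : HasFDerivAt (velocityOperator q p ∘ v) C (l • ξ) := by
          refine (C.hasFDerivAt (x := l • ξ)).congr_of_eventuallyEq ?_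
          filter_upwards [Metric.isOpen_ball.mem_nhds hξ] with ζ hζ
          exact hveq ζ hζ
        exact congrArg (fun L : E →L[ℝ] C(Set.Icc (-1 : ℝ) 1, E) => L (l • η)) (h1.unique h2)
      refine ⟨fun t => l⁻¹ • extendTime (fderiv ℝ v (l • ξ) (l • η)) (t / l), fun t ht => ⟨?_, ?_⟩⟩
      · have h1 := (hasDerivAt_primitive (fderiv ℝ v (l • ξ) (l • η)) (habs t ht)).scomp t (hdiv t)
        refine h1.congr_of_eventuallyEq ?_
        filter_upwards [hnear t ht] with s hs
        rw [hfd s hs]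
        rfl
      · have h1 := ((hasDerivAt_of_linearised_eq hlin (habs t ht)).scomp t
          (hdiv t)).const_smul l⁻¹
        convert! h1 using 1
        rw [hF t ht, hfd t ht, hq'_apply]
        simp [V, smul_add, add_assoc]

end Flow

/-! ### The Levi-Civita connection of a metric in coordinates -/

section Metric

variable {E : Type*} [NormedAddCommGroup E] [NormedSpace ℝ E]

/-- `G` is a smooth Riemannian metric on the open set `U`. -/
structure IsMetricOn (G : E → E →L[ℝ] E →L[ℝ] ℝ) (U : Set E) : Prop where
  isOpen : IsOpen U
  contDiffOn : ContDiffOn ℝ ∞ G U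
  symm : ∀ y ∈ U, ∀ u v, G y u v = G y v u
  pos : ∀ y ∈ U, ∀ v, v ≠ 0 → 0 < G y v v

namespace IsMetricOn

variable {G : E → E →L[ℝ] E →L[ℝ] ℝ} {U : Set E} (h : IsMetricOn G U)

include h

theorem contDiffAt {y : E} (hy : y ∈ U) : ContDiffAt ℝ ∞ G y :=
  h.contDiffOn.contDiffAt (h.isOpen.mem_nhds hy)

theorem hasFDerivAt {y : E} (hy : y ∈ U) : HasFDerivAt G (fderiv ℝ G y) y :=
  ((h.contDiffAt hy).differentiableAt (by simp)).hasFDerivAt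

theorem eq_of_forall_apply_eq {y : E} (hy : y ∈ U) {a b : E} (hab : ∀ w, G y a w = G y b w) :
    a = b := by
  by_contra hne
  have h1 := h.pos y hy (a - b) (sub_ne_zero.2 hne)
  have h2 := hab (a - b)
  rw [map_sub (G y), sub_apply, h2, sub_self] at h1
  exact lt_irrefl _ h1

theorem fderiv_symm {y : E} (hy : y ∈ U) (w u v : E) :
    fderiv ℝ G y w u v = fderiv ℝ G y w v u := by
  have h1 : ∀ a b : E, HasFDerivAt (fun z => G z a b)
      ((ContinuousLinearMap.apply ℝ ℝ b) ∘L (ContinuousLinearMap.apply ℝ (E →L[ℝ] ℝ) a) ∘L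
        fderiv ℝ G y) y := fun a b =>
    ((ContinuousLinearMap.apply ℝ ℝ b) ∘L
      (ContinuousLinearMap.apply ℝ (E →L[ℝ] ℝ) a)).hasFDerivAt.comp y (h.hasFDerivAt hy)
  have h2 : (fun z => G z u v) =ᶠ[𝓝 y] fun z => G z v u := by
    filter_upwards [h.isOpen.mem_nhds hy] with z hz using h.symm z hz u v
  exact congrArg (fun L : E →L[ℝ] ℝ => L w) ((h1 u v).unique ((h1 v u).congr_of_eventuallyEq h2))

theorem christoffelFirst_symm {y : E} (hy : y ∈ U) (u v w : E) :
    christoffelFirst G y u v w = christoffelFirst G y v u w := by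
  rw [christoffelFirst_apply, christoffelFirst_apply, h.fderiv_symm hy w u v]
  ring

theorem christoffel_symm {y : E} (hy : y ∈ U) (u v : E) :
    christoffel G y u v = christoffel G y v u := by
  rw [christoffel_apply, christoffel_apply]
  congr 1
  ext w
  exact h.christoffelFirst_symm hy u v w

variable [FiniteDimensional ℝ E]

theorem isInvertible {y : E} (hy : y ∈ U) : (G y).IsInvertible := by
  have hinj : Function.Injective ((LinearMap.toContinuousLinearMap (𝕜 := ℝ) (E := E)
      (F' := ℝ)).symm.toLinearMap ∘ₗ (G y).toLinearMap) := by
    intro a b hab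
    exact h.eq_of_forall_apply_eq hy fun w => LinearMap.congr_fun hab w
  let e := LinearEquiv.ofInjectiveOfFinrankEq _ hinj (Subspace.dual_finrank_eq (K := ℝ) (V := E)).symm
  let e' : E ≃ₗ[ℝ] (E →L[ℝ] ℝ) := e.trans LinearMap.toContinuousLinearMap
  refine ⟨e'.toContinuousLinearEquiv, ?_⟩
  ext a b
  rfl

theorem apply_christoffel {y : E} (hy : y ∈ U) (u v w : E) :
    G y (christoffel G y u v) w = christoffelFirst G y u v w := by
  rw [christoffel_apply, (h.isInvertible hy).self_apply_inverse]

/-- The Levi-Civita connection is compatible with the metric. -/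
theorem fderiv_apply_eq {y : E} (hy : y ∈ U) (w u v : E) :
    fderiv ℝ G y w u v = G y (christoffel G y w u) v + G y u (christoffel G y w v) := by
  rw [h.symm y hy u, h.apply_christoffel hy, h.apply_christoffel hy, christoffelFirst_apply,
    christoffelFirst_apply, h.fderiv_symm hy w v u]
  ring

theorem contDiffOn_christoffelFirst : ContDiffOn ℝ ∞ (christoffelFirst G) U := by
  have hD : ContDiffOn ℝ ∞ (fderiv ℝ G) U := h.contDiffOn.fderiv_of_isOpen h.isOpen (by simp)
  refine contDiffOn_clm_apply.2 fun u => contDiffOn_clm_apply.2 fun v =>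
    contDiffOn_clm_apply.2 fun w => ?_
  simp only [christoffelFirst_apply]
  have key : ∀ a b c : E, ContDiffOn ℝ ∞ (fun y => fderiv ℝ G y a b c) U := fun a b c =>
    ((hD.clm_apply contDiffOn_const).clm_apply contDiffOn_const).clm_apply contDiffOn_const
  exact (((key u v w).add (key v u w)).sub (key w u v)).div_const 2

theorem contDiffOn_christoffel : ContDiffOn ℝ ∞ (christoffel G) U := by
  have hinv : ContDiffOn ℝ ∞ (fun y => (G y).inverse) U := fun y hy =>
    (((h.isInvertible hy).contDiffAt_map_inverse).comp y (h.contDiffAt hy)).contDiffWithinAt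
  refine contDiffOn_clm_apply.2 fun u => contDiffOn_clm_apply.2 fun v => ?_
  simp only [christoffel_apply]
  exact hinv.clm_apply ((h.contDiffOn_christoffelFirst.clm_apply contDiffOn_const).clm_apply
    contDiffOn_const)

theorem contDiffAt_christoffel {y : E} (hy : y ∈ U) : ContDiffAt ℝ ∞ (christoffel G) y :=
  h.contDiffOn_christoffel.contDiffAt (h.isOpen.mem_nhds hy)

theorem hasFDerivAt_christoffel {y : E} (hy : y ∈ U) :
    HasFDerivAt (christoffel G) (fderiv ℝ (christoffel G) y) y :=
  ((h.contDiffAt_christoffel hy).differentiableAt (by simp)).hasFDerivAt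

end IsMetricOn

/-- **Transformation law of the Christoffel symbols** under a change of coordinates `φ`. -/
theorem christoffel_transform [FiniteDimensional ℝ E] {G G' : E → E →L[ℝ] E →L[ℝ] ℝ} {U U' : Set E}
    (h : IsMetricOn G U) (h' : IsMetricOn G' U') {φ : E → E} {y : E} (hy : y ∈ U) (hy' : φ y ∈ U')
    (hφ : ContDiffAt ℝ 2 φ y) (hinv : Function.Surjective (fderiv ℝ φ y))
    (hG : ∀ᶠ z in 𝓝 y, ∀ u v, G z u v = G' (φ z) (fderiv ℝ φ z u) (fderiv ℝ φ z v)) (u v : E) :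
    fderiv ℝ φ y (christoffel G y u v) =
      fderiv ℝ (fderiv ℝ φ) y u v +
        christoffel G' (φ y) (fderiv ℝ φ y u) (fderiv ℝ φ y v) := by
  set L := fderiv ℝ φ y with hL
  set B := fderiv ℝ (fderiv ℝ φ) y with hB
  have hd : HasFDerivAt φ L y := (hφ.differentiableAt (by simp)).hasFDerivAt
  have hdd : HasFDerivAt (fderiv ℝ φ) B y :=
    ((hφ.fderiv_right (m := 1) (by norm_num)).differentiableAt (by simp)).hasFDerivAt
  have hBs : ∀ a b, B a b = B b a := fun a b =>
    (hφ.isSymmSndFDerivAt (by simp)).eq a b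
  have hG' : HasFDerivAt (fun z => G' (φ z)) (fderiv ℝ G' (φ y) ∘L L) y :=
    (h'.hasFDerivAt hy').comp y hd
  have hderiv : ∀ a b c, fderiv ℝ G y a b c = fderiv ℝ G' (φ y) (L a) (L b) (L c)
      + G' (φ y) (B a b) (L c) + G' (φ y) (L b) (B a c) := by
    intro a b c
    have h1 := ((h.hasFDerivAt hy).clm_apply (hasFDerivAt_const b y)).clm_apply
      (hasFDerivAt_const c y)
    have h2 := (hG'.clm_apply (hdd.clm_apply (hasFDerivAt_const b y))).clm_apply
      (hdd.clm_apply (hasFDerivAt_const c y))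
    have h3 := h1.unique (h2.congr_of_eventuallyEq (by
      filter_upwards [hG] with z hz using hz b c))
    have h4 := congrArg (fun T : E →L[ℝ] ℝ => T a) h3
    simp at h4
    rw [h4]
    ring
  refine h'.eq_of_forall_apply_eq hy' fun w' => ?_
  obtain ⟨w, rfl⟩ := hinv w'
  have h1 : G' (φ y) (L (christoffel G y u v)) (L w) = G y (christoffel G y u v) w :=
    (hG.self_of_nhds _ _).symm
  rw [h1, h.apply_christoffel hy, map_add, add_apply, h'.apply_christoffel hy',
    christoffelFirst_apply, christoffelFirst_apply, hderiv, hderiv, hderiv, hBs v u, hBs w u,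
    hBs w v, h'.symm _ hy' (L v) (B u w), h'.symm _ hy' (L u) (B v w)]
  ring

end Metric

/-! ### Smoothness of the iterated covariant derivatives of the curvature -/

section CovariantDerivative

variable {E : Type*} [NormedAddCommGroup E] [NormedSpace ℝ E]

theorem contDiffOn_of_forall_multilinear_apply [FiniteDimensional ℝ E] {n : WithTop ℕ∞} {U : Set E} : ∀ {r : ℕ}
    {T : E → ContinuousMultilinearMap ℝ (fun _ : Fin r => E) ℝ},
    (∀ v, ContDiffOn ℝ n (fun y => T y v) U) → ContDiffOn ℝ n T U
  | 0, T, hT => by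
    have h1 := (continuousMultilinearCurryFin0 ℝ E ℝ).symm.contDiff.comp_contDiffOn (hT 0)
    refine h1.congr fun y _ => ?_
    ext v
    simp [Subsingleton.elim v 0]
  | r + 1, T, hT => by
    let e := continuousMultilinearCurryLeftEquiv ℝ (fun _ : Fin (r + 1) => E) ℝ
    have h1 : ContDiffOn ℝ n (fun y => e (T y)) U := by
      refine contDiffOn_clm_apply.2 fun u => contDiffOn_of_forall_multilinear_apply fun v => ?_
      exact hT (Fin.cons u v)
    have h2 := e.symm.contDiff.comp_contDiffOn h1
    refine h2.congr fun y _ => ?_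
    simp

theorem contDiffOn_multilinear_apply {D : Type*} [NormedAddCommGroup D] [NormedSpace ℝ D]
    {n : WithTop ℕ∞} {U : Set D} : ∀ {r : ℕ}
    {T : D → ContinuousMultilinearMap ℝ (fun _ : Fin r => E) ℝ} (_ : ContDiffOn ℝ n T U)
    {v : Fin r → D → E} (_ : ∀ i, ContDiffOn ℝ n (v i) U),
    ContDiffOn ℝ n (fun y => T y fun i => v i y) U
  | 0, T, hT, v, _ => by
    have h1 := (continuousMultilinearCurryFin0 ℝ E ℝ).contDiff.comp_contDiffOn hT
    refine h1.congr fun y _ => ?_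
    simp [Subsingleton.elim (fun i => v i y) 0]
  | r + 1, T, hT, v, hv => by
    let e := continuousMultilinearCurryLeftEquiv ℝ (fun _ : Fin (r + 1) => E) ℝ
    have h1 : ContDiffOn ℝ n (fun y => e (T y) (v 0 y)) U :=
      (e.contDiff.comp_contDiffOn hT).clm_apply (hv 0)
    have h2 := contDiffOn_multilinear_apply h1 fun i => hv i.succ
    refine h2.congr fun y _ => ?_
    change T y _ = T y (Fin.cons (v 0 y) fun i => v i.succ y)
    congr 1
    funext i
    exact Fin.cases rfl (fun j => rfl) i

/-- Along a curve with velocity `c'`, the derivative of a covariant tensor evaluated on parallel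
fields is its covariant derivative in the direction `c'`. -/
theorem hasDerivAt_tensor_parallel {G : E → E →L[ℝ] E →L[ℝ] ℝ} {U : Set E}
    (hUo : IsOpen U) {r : ℕ}
    {T : E → ContinuousMultilinearMap ℝ (fun _ : Fin r => E) ℝ} (hT : ContDiffOn ℝ ∞ T U)
    {c : ℝ → E} {c' : E} {t : ℝ} (hc : HasDerivAt c c' t) (hU : c t ∈ U) {V : ℝ → Fin r → E}
    (hV : ∀ i, HasDerivAt (fun s => V s i) (-christoffel G (c t) c' (V t i)) t) :
    HasDerivAt (fun s => T (c s) (V s))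
      (covDeriv G T (c t) (Fin.snoc (V t) c' : Fin (r + 1) → E)) t := by
  have hTd : HasFDerivAt T (fderiv ℝ T (c t)) (c t) :=
    ((hT.contDiffAt (hUo.mem_nhds hU)).differentiableAt (by simp)).hasFDerivAt
  have h1 : HasFDerivAt (fun s => T (c s)) _ t := (hTd.comp_hasDerivAt t hc).hasFDerivAt
  have h2 := (h1.continuousMultilinearMap_apply fun i => (hV i).hasFDerivAt).hasDerivAt
  refine h2.congr_deriv ?_
  rw [covDeriv_apply]
  simp only [add_apply, ContinuousLinearMap.comp_apply, sum_apply,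
    ContinuousLinearMap.toSpanSingleton_apply, one_smul, ContinuousMultilinearMap.apply_apply,
    ContinuousMultilinearMap.toContinuousLinearMap_apply, sub_eq_add_neg,
    ← Finset.sum_neg_distrib]
  congr 1
  exact Finset.sum_congr rfl fun i _ => (T (c t)).toMultilinearMap.map_update_neg _ _ _

namespace IsMetricOn

variable [FiniteDimensional ℝ E] {G : E → E →L[ℝ] E →L[ℝ] ℝ} {U : Set E} (h : IsMetricOn G U)

include h

theorem contDiffOn_curvatureTensor : ContDiffOn ℝ ∞ (curvatureTensor G) U := by
  refine contDiffOn_of_forall_multilinear_apply fun v => ?_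
  simp only [curvatureTensor_apply, curvatureOperator]
  have hΓ := h.contDiffOn_christoffel
  have hD : ContDiffOn ℝ ∞ (fderiv ℝ (christoffel G)) U :=
    hΓ.fderiv_of_isOpen h.isOpen (by simp)
  have h1 : ∀ a b c : E, ContDiffOn ℝ ∞ (fun y => fderiv ℝ (christoffel G) y a b c) U :=
    fun a b c =>
      ((hD.clm_apply contDiffOn_const).clm_apply contDiffOn_const).clm_apply contDiffOn_const
  have h2 : ∀ a b c : E, ContDiffOn ℝ ∞ (fun y => christoffel G y a (christoffel G y b c)) U :=
    fun a b c => (hΓ.clm_apply contDiffOn_const).clm_apply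
      ((hΓ.clm_apply contDiffOn_const).clm_apply contDiffOn_const)
  exact (h.contDiffOn.clm_apply ((((h1 _ _ _).sub (h1 _ _ _)).add (h2 _ _ _)).sub
    (h2 _ _ _))).clm_apply contDiffOn_const

theorem contDiffOn_covDeriv {r : ℕ} {T : E → ContinuousMultilinearMap ℝ (fun _ : Fin r => E) ℝ}
    (hT : ContDiffOn ℝ ∞ T U) : ContDiffOn ℝ ∞ (covDeriv G T) U := by
  refine contDiffOn_of_forall_multilinear_apply fun v => ?_
  rw [← Fin.snoc_init_self v]
  simp only [covDeriv_apply]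
  have hD : ContDiffOn ℝ ∞ (fderiv ℝ T) U := hT.fderiv_of_isOpen h.isOpen (by simp)
  refine ContDiffOn.sub ?_ (ContDiffOn.sum fun a _ => ?_)
  · exact contDiffOn_multilinear_apply (hD.clm_apply contDiffOn_const) fun i => contDiffOn_const
  · refine contDiffOn_multilinear_apply
      (v := fun i y => Function.update (Fin.init v) a
        (christoffel G y (v (Fin.last r)) (Fin.init v a)) i) hT fun i => ?_
    rcases eq_or_ne i a with rfl | hi
    · simpa using (h.contDiffOn_christoffel.clm_apply contDiffOn_const).clm_apply contDiffOn_const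
    · simpa [hi] using contDiffOn_const

theorem contDiffOn_covDerivCurvature : ∀ k, ContDiffOn ℝ ∞ (covDerivCurvature G k) U
  | 0 => h.contDiffOn_curvatureTensor
  | k + 1 => h.contDiffOn_covDeriv (contDiffOn_covDerivCurvature k)

end IsMetricOn

end CovariantDerivative

/-! ### The exponential map in coordinates -/

section LocalExponential

universe u

variable {E : Type u} [NormedAddCommGroup E] [NormedSpace ℝ E]

/-- `F` is the exponential map at `p`, in coordinates, of the metric `G` on `U`: it is smooth on the
ball of radius `r`, its radial curves are geodesics, and the derivatives of these in the initial
velocity solve the linearised geodesic equation. -/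
structure IsLocalExponential (G : E → E →L[ℝ] E →L[ℝ] ℝ) (U : Set E) (p : E) (F : E → E) (r : ℝ) :
    Prop where
  pos : 0 < r
  map_zero : F 0 = p
  hasFDerivAt_zero : HasFDerivAt F (ContinuousLinearMap.id ℝ E) 0
  contDiffOn : ContDiffOn ℝ ∞ F (Metric.ball 0 r)
  mapsTo : ∀ x ∈ Metric.ball (0 : E) r, F x ∈ U
  radial : ∀ (ξ : E) (l : ℝ), 0 < l → l • ξ ∈ Metric.ball (0 : E) r →
    ∃ v : ℝ → E, (∀ t, |t| < l → HasDerivAt (fun s => F (s • ξ)) (v t) t ∧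
      HasDerivAt v (-christoffel G (F (t • ξ)) (v t) (v t)) t) ∧
    ∀ η : E, ∃ w : ℝ → E, ∀ t, |t| < l →
      HasDerivAt (fun s => s • fderiv ℝ F (s • ξ) η) (w t) t ∧
      HasDerivAt w (-(fderiv ℝ (christoffel G) (F (t • ξ)) (t • fderiv ℝ F (t • ξ) η) (v t) (v t)
        + christoffel G (F (t • ξ)) (w t) (v t) + christoffel G (F (t • ξ)) (v t) (w t))) t

theorem smul_mem_ball_of_abs_lt {ξ : E} {l t r : ℝ} (hξ : l • ξ ∈ Metric.ball (0 : E) r)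
    (ht : |t| < l) : t • ξ ∈ Metric.ball (0 : E) r := by
  rw [mem_ball_zero_iff, norm_smul, Real.norm_eq_abs] at *
  exact lt_of_le_of_lt (mul_le_mul_of_nonneg_right (ht.le.trans (le_abs_self l)) (norm_nonneg ξ)) hξ

variable [FiniteDimensional ℝ E]

theorem IsMetricOn.exists_localExponential {G : E → E →L[ℝ] E →L[ℝ] ℝ} {U : Set E}
    (h : IsMetricOn G U) {p : E} (hp : p ∈ U) : ∃ F r, IsLocalExponential G U p F r := by
  -- a cutoff makes the connection smooth on the whole space
  obtain ⟨ε, hε, hεU⟩ := Metric.isOpen_iff.1 h.isOpen p hp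
  let χ : ContDiffBump p := ⟨ε / 4, ε / 2, by positivity, by linarith⟩
  let Q : E → E →L[ℝ] E →L[ℝ] E := fun y => χ y • christoffel G y
  have hQ : ContDiff ℝ ∞ Q := by
    refine contDiff_iff_contDiffAt.2 fun y => ?_
    by_cases hy : y ∈ U
    · exact χ.contDiff.contDiffAt.smul (h.contDiffAt_christoffel hy)
    · have hy' : y ∉ tsupport χ := by
        rw [χ.tsupport_eq]
        intro hy2
        have h2 : ε / 2 < ε := by linarith
        exact hy (hεU (Metric.closedBall_subset_ball h2 hy2))
      refine (contDiffAt_const (c := (0 : E →L[ℝ] E →L[ℝ] E))).congr_of_eventuallyEq ?_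
      filter_upwards [notMem_tsupport_iff_eventuallyEq.1 hy'] with z hz
      simp [Q, hz]
  have hQeq : ∀ y ∈ Metric.ball p (ε / 4), Q =ᶠ[𝓝 y] christoffel G := by
    intro y hy
    filter_upwards [Metric.isOpen_ball.mem_nhds hy] with z hz
    have : χ z = 1 := χ.one_of_mem_closedBall (Metric.ball_subset_closedBall hz)
    simp [Q, this]
  obtain ⟨F, r₀, hr₀, hF0, hF1, hFs, hF⟩ := exists_exponential Q hQ p
  have hcont : ContinuousAt F 0 := hF1.continuousAt
  have hnear : ∀ᶠ x in 𝓝 (0 : E), F x ∈ Metric.ball p (ε / 4) := by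
    refine hcont.eventually ?_
    rw [hF0]
    exact Metric.ball_mem_nhds _ (by positivity)
  obtain ⟨r₁, hr₁, hball⟩ := Metric.eventually_nhds_iff_ball.1 hnear
  have hsub : Metric.ball (0 : E) (min r₀ r₁) ⊆ Metric.ball 0 r₀ :=
    Metric.ball_subset_ball (min_le_left _ _)
  have hsub' : Metric.ball (0 : E) (min r₀ r₁) ⊆ Metric.ball 0 r₁ :=
    Metric.ball_subset_ball (min_le_right _ _)
  refine ⟨F, min r₀ r₁, lt_min hr₀ hr₁, hF0, hF1, hFs.mono hsub, ?_, ?_⟩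
  · intro x hx
    exact hεU (Metric.ball_subset_ball (by linarith) (hball x (hsub' hx)))
  · intro ξ l hl hξ
    obtain ⟨v, hv, hw⟩ := hF ξ l hl (hsub hξ)
    have hmem : ∀ t : ℝ, |t| < l → F (t • ξ) ∈ Metric.ball p (ε / 4) := fun t ht =>
      hball _ (hsub' (smul_mem_ball_of_abs_lt hξ ht))
    refine ⟨v, fun t ht => ?_, fun η => ?_⟩
    · rw [← (hQeq _ (hmem t ht)).eq_of_nhds]
      exact hv t ht
    · obtain ⟨w, hw⟩ := hw η
      refine ⟨w, fun t ht => ?_⟩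
      rw [← (hQeq _ (hmem t ht)).eq_of_nhds, ← (hQeq _ (hmem t ht)).fderiv_eq]
      exact hw t ht

end LocalExponential

/-! ### Parallel frames and the Jacobi equation -/

section LinearODE

variable {E : Type*} [NormedAddCommGroup E] [NormedSpace ℝ E] [CompleteSpace E]

/-- A linear equation `P' = B P` with smooth coefficients has a smooth operator-valued solution with
`P(0) = id`, near `0`. -/
theorem exists_linear_ode {B : ℝ → E →L[ℝ] E} {l : ℝ} (hl : 0 < l)
    (hB : ContDiffOn ℝ ∞ B (Set.Ioo (-l) l)) :
    ∃ ε > 0, ε ≤ l ∧ ∃ P : ℝ → E →L[ℝ] E, P 0 = ContinuousLinearMap.id ℝ E ∧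
      (∀ t ∈ Set.Ioo (-ε) ε, HasDerivAt P (B t ∘L P t) t) ∧
      ContDiffOn ℝ ∞ P (Set.Ioo (-ε) ε) := by
  have hB0 : ContDiffAt ℝ ∞ B 0 := hB.contDiffAt (Ioo_mem_nhds (by linarith) hl)
  let f : ℝ × (E →L[ℝ] E) → ℝ × (E →L[ℝ] E) := fun x => (1, B x.1 ∘L x.2)
  have hf : ContDiffAt ℝ 1 f (0, ContinuousLinearMap.id ℝ E) := by
    have h1 : ContDiffAt ℝ 1 (fun x : ℝ × (E →L[ℝ] E) => B x.1)
        (0, ContinuousLinearMap.id ℝ E) :=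
      ContDiffAt.comp (g := B) _ (hB0.of_le (by simp)) contDiffAt_fst
    exact contDiffAt_const.prodMk (h1.clm_comp contDiffAt_snd)
  obtain ⟨α, hα0, ε, hε, hα⟩ :=
    hf.exists_forall_mem_closedBall_exists_eq_forall_mem_Ioo_hasDerivAt₀ 0
  simp only [zero_sub, zero_add] at hα
  have hfst : ∀ t ∈ Set.Ioo (-ε) ε, (α t).1 = t := by
    intro t ht
    have hd : ∀ s ∈ Set.Ioo (-ε) ε, HasDerivAt (fun s => (α s).1 - s) 0 s := by
      intro s hs
      have h1 : HasDerivAt (fun s => (α s).1) 1 s := (hα s hs).fst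
      simpa using! h1.sub (hasDerivAt_id s)
    have h0 : (0 : ℝ) ∈ Set.Ioo (-ε) ε := ⟨by linarith, hε⟩
    have := isOpen_Ioo.is_const_of_deriv_eq_zero isPreconnected_Ioo
      (fun s hs => (hd s hs).differentiableAt.differentiableWithinAt)
      (fun s hs => (hd s hs).deriv) ht h0
    simp only [hα0, sub_zero] at this
    linarith
  refine ⟨min ε l, lt_min hε hl, min_le_right _ _, fun t => (α t).2, by simp [hα0], ?_, ?_⟩
  · intro t ht
    have ht' : t ∈ Set.Ioo (-ε) ε :=
      ⟨by linarith [ht.1, min_le_left ε l], ht.2.trans_le (min_le_left _ _)⟩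
    have h1 : HasDerivAt (fun s => (α s).2) (f (α t)).2 t := (hα t ht').snd
    simpa only [f, hfst t ht'] using h1
  · have hsub : Set.Ioo (-min ε l) (min ε l) ⊆ Set.Ioo (-ε) ε :=
      Set.Ioo_subset_Ioo (by linarith [min_le_left ε l]) (min_le_left _ _)
    have hsub' : Set.Ioo (-min ε l) (min ε l) ⊆ Set.Ioo (-l) l :=
      Set.Ioo_subset_Ioo (by linarith [min_le_right ε l]) (min_le_right _ _)
    have hd : ∀ t ∈ Set.Ioo (-min ε l) (min ε l),
        HasDerivAt (fun s => (α s).2) (B t ∘L (α t).2) t := by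
      intro t ht
      have h1 : HasDerivAt (fun s => (α s).2) (f (α t)).2 t := (hα t (hsub ht)).snd
      simpa only [f, hfst t (hsub ht)] using h1
    refine contDiffOn_infty.2 fun n => ?_
    induction n with
    | zero =>
      exact contDiffOn_zero.2 fun t ht => (hd t ht).continuousAt.continuousWithinAt
    | succ n ih =>
      rw [Nat.cast_add, Nat.cast_one]
      refine (contDiffOn_succ_iff_deriv_of_isOpen isOpen_Ioo).2
        ⟨fun t ht => (hd t ht).differentiableAt.differentiableWithinAt,
          fun hn => absurd hn (WithTop.coe_ne_top), ?_⟩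
      refine (((hB.mono hsub').of_le (by exact_mod_cast le_top)).clm_comp ih).congr fun t ht => ?_
      exact (hd t ht).deriv

end LinearODE

section Jacobi

universe u

variable {E : Type u} [NormedAddCommGroup E] [NormedSpace ℝ E] [FiniteDimensional ℝ E]

theorem snoc_update_update {X : Type*} (v x y : X) (k : ℕ) :
    (Fin.snoc (Function.update (Function.update (fun _ => v) (Fin.castAdd k (0 : Fin 4)) x)
      (Fin.castAdd k (3 : Fin 4)) y : Fin (4 + k) → X) v : Fin (4 + k + 1) → X) =
    Function.update (Function.update (fun _ => v) (Fin.castAdd (k + 1) (0 : Fin 4)) x)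
      (Fin.castAdd (k + 1) (3 : Fin 4)) y := by
  rw [Fin.snoc_update, Fin.snoc_update]
  have : (Fin.snoc (fun _ : Fin (4 + k) => v) v : Fin (4 + k + 1) → X) = fun _ => v := by
    funext i
    exact Fin.lastCases (by simp) (fun j => by simp) i
  rw [this]
  rfl

/-- The Jacobi operator `u ↦ R(u, v) v` of the metric `G`, in coordinates. -/
def jacobiEnd (G : E → E →L[ℝ] E →L[ℝ] ℝ) (y v : E) : E →L[ℝ] E :=
  LinearMap.toContinuousLinearMap
    { toFun := fun u => curvatureOperator G y u v v
      map_add' := fun a b => by simp [curvatureOperator]; abel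
      map_smul' := fun c a => by simp [curvatureOperator, smul_sub, smul_add] }

theorem jacobiEnd_apply (G : E → E →L[ℝ] E →L[ℝ] ℝ) (y v u : E) :
    jacobiEnd G y v u = curvatureOperator G y u v v := rfl

theorem IsMetricOn.contDiffOn_jacobiEnd {G : E → E →L[ℝ] E →L[ℝ] ℝ} {U : Set E}
    (h : IsMetricOn G U) {c v : ℝ → E} {I : Set ℝ} (hc : ContDiffOn ℝ ∞ c I)
    (hcU : ∀ t ∈ I, c t ∈ U) (hv : ContDiffOn ℝ ∞ v I) :
    ContDiffOn ℝ ∞ (fun t => jacobiEnd G (c t) (v t)) I := by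
  have hΓ : ContDiffOn ℝ ∞ (fun t => christoffel G (c t)) I :=
    h.contDiffOn_christoffel.comp hc hcU
  have hD : ContDiffOn ℝ ∞ (fun t => fderiv ℝ (christoffel G) (c t)) I :=
    (h.contDiffOn_christoffel.fderiv_of_isOpen h.isOpen (by simp)).comp hc hcU
  refine contDiffOn_clm_apply.2 fun u => ?_
  have hu : ContDiffOn ℝ ∞ (fun _ : ℝ => u) I := contDiffOn_const
  simp only [jacobiEnd_apply, curvatureOperator]
  exact (((((hD.clm_apply hu).clm_apply hv).clm_apply hv).sub
    (((hD.clm_apply hv).clm_apply hu).clm_apply hv)).add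
    ((hΓ.clm_apply hu).clm_apply ((hΓ.clm_apply hv).clm_apply hv))).sub
    ((hΓ.clm_apply hv).clm_apply ((hΓ.clm_apply hu).clm_apply hv))

/-- In a parallel frame `P` along a geodesic `c`, the derivatives of the components of the Jacobi
operator are the components of the iterated covariant derivatives of the curvature. -/
theorem IsMetricOn.hasDerivAt_covDerivCurvature_parallel {G : E → E →L[ℝ] E →L[ℝ] ℝ} {U : Set E}
    (h : IsMetricOn G U) {c v V W : ℝ → E} {t : ℝ} (hU : c t ∈ U) (hc : HasDerivAt c (v t) t)
    (hv : HasDerivAt v (-christoffel G (c t) (v t) (v t)) t)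
    (hV : HasDerivAt V (-christoffel G (c t) (v t) (V t)) t)
    (hW : HasDerivAt W (-christoffel G (c t) (v t) (W t)) t) (k : ℕ) :
    HasDerivAt (fun s => jacobiForm G (c s) k (v s) (V s) (W s))
      (jacobiForm G (c t) (k + 1) (v t) (V t) (W t)) t := by
  have h1 := hasDerivAt_tensor_parallel h.isOpen (h.contDiffOn_covDerivCurvature k) hc hU
    (V := fun s => Function.update (Function.update (fun _ => v s) (Fin.castAdd k (0 : Fin 4)) (V s))
      (Fin.castAdd k (3 : Fin 4)) (W s)) (fun i => by
        by_cases h3 : i = Fin.castAdd k (3 : Fin 4)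
        · subst h3
          simpa using hW
        · by_cases h0 : i = Fin.castAdd k (0 : Fin 4)
          · subst h0
            simpa [h3] using hV
          · simpa [h3, h0] using hv)
  rw [snoc_update_update] at h1
  exact h1

/-- Parallel transport is isometric. -/
theorem IsMetricOn.hasDerivAt_inner_parallel {G : E → E →L[ℝ] E →L[ℝ] ℝ} {U : Set E}
    (h : IsMetricOn G U) {c V W : ℝ → E} {v : E} {t : ℝ} (hU : c t ∈ U) (hc : HasDerivAt c v t)
    (hV : HasDerivAt V (-christoffel G (c t) v (V t)) t)
    (hW : HasDerivAt W (-christoffel G (c t) v (W t)) t) :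
    HasDerivAt (fun s => G (c s) (V s) (W s)) 0 t := by
  have h1 := (((h.hasFDerivAt hU).comp_hasDerivAt t hc).clm_apply hV).clm_apply hW
  refine h1.congr_deriv ?_
  simp only [add_apply, map_neg, neg_apply, h.fderiv_apply_eq hU, Function.comp_apply]
  ring

/-- **The Jacobi equation.** If `v' = -Γ(v, v)` and `Y`, with `Y' = w`, solves the linearisation of
this equation, then the covariant derivative of `w + Γ(v, Y)` along the curve is `-R(Y, v) v`. -/
theorem IsMetricOn.hasDerivAt_covDeriv_jacobi {G : E → E →L[ℝ] E →L[ℝ] ℝ} {U : Set E}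
    (h : IsMetricOn G U) {c v Y w : ℝ → E} {t : ℝ} (hU : c t ∈ U) (hc : HasDerivAt c (v t) t)
    (hv : HasDerivAt v (-christoffel G (c t) (v t) (v t)) t) (hY : HasDerivAt Y (w t) t)
    (hw : HasDerivAt w (-(fderiv ℝ (christoffel G) (c t) (Y t) (v t) (v t)
        + christoffel G (c t) (w t) (v t) + christoffel G (c t) (v t) (w t))) t) :
    HasDerivAt (fun s => w s + christoffel G (c s) (v s) (Y s))
      (-christoffel G (c t) (v t) (w t + christoffel G (c t) (v t) (Y t))
        - curvatureOperator G (c t) (Y t) (v t) (v t)) t := by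
  have h1 := (((h.hasFDerivAt_christoffel hU).comp_hasDerivAt t hc).clm_apply hv).clm_apply hY
  refine (hw.add h1).congr_deriv ?_
  simp only [curvatureOperator, add_apply, map_neg, neg_apply, map_add, Function.comp_apply]
  rw [h.christoffel_symm hU (w t) (v t),
    h.christoffel_symm hU (christoffel G (c t) (v t) (v t)) (Y t),
    h.christoffel_symm hU (Y t) (v t)]
  have hsymm : fderiv ℝ (christoffel G) (c t) (v t) (v t) (Y t) =
      fderiv ℝ (christoffel G) (c t) (v t) (Y t) (v t) := by
    have h2 : ∀ a b : E, HasFDerivAt (fun z => christoffel G z a b)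
        ((ContinuousLinearMap.apply ℝ E b) ∘L (ContinuousLinearMap.apply ℝ (E →L[ℝ] E) a) ∘L
          fderiv ℝ (christoffel G) (c t)) (c t) := fun a b =>
      ((ContinuousLinearMap.apply ℝ E b) ∘L
        (ContinuousLinearMap.apply ℝ (E →L[ℝ] E) a)).hasFDerivAt.comp (c t)
          (h.hasFDerivAt_christoffel hU)
    have h3 : (fun z => christoffel G z (v t) (Y t)) =ᶠ[𝓝 (c t)]
        fun z => christoffel G z (Y t) (v t) := by
      filter_upwards [h.isOpen.mem_nhds hU] with z hz using h.christoffel_symm hz _ _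
    exact congrArg (fun L : E →L[ℝ] E => L (v t))
      ((h2 (v t) (Y t)).unique ((h2 (Y t) (v t)).congr_of_eventuallyEq h3))
  rw [hsymm]
  abel

/-- The differential of the exponential map along the ray through `ξ`, expressed in a parallel frame
`P` as `dF(tξ) = P(t) a(t)`, where `A(t) = t a(t)` satisfies the Jacobi equation `A'' + R A = 0` and
the Taylor coefficients of `R` are the operators `𝒥_k(ξ)`. -/
theorem IsMetricOn.exists_jacobi_matrix {G : E → E →L[ℝ] E →L[ℝ] ℝ} {U : Set E}
    (h : IsMetricOn G U) {p : E} (hp : p ∈ U) {F : E → E} {r : ℝ}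
    (hF : IsLocalExponential G U p F r) (ξ : E) :
    ∃ ε > 0, ∃ P a R : ℝ → E →L[ℝ] E,
      ContDiffOn ℝ ∞ a (Set.Ioo (-ε) ε) ∧ ContDiffOn ℝ ∞ R (Set.Ioo (-ε) ε) ∧ a 0 = 1 ∧
      (∀ t ∈ Set.Ioo (-ε) ε, ∀ η, fderiv ℝ F (t • ξ) η = P t (a t η)) ∧
      (∀ t ∈ Set.Ioo (-ε) ε, ∀ x y, G (F (t • ξ)) (P t x) (P t y) = G p x y) ∧
      (∀ t ∈ Set.Ioo (-ε) ε, deriv (deriv fun s => s • a s) t = -(R t * (t • a t))) ∧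
      ∀ k η ζ, G p (iteratedDeriv k R 0 η) ζ = jacobiForm G p k ξ η ζ := by
  obtain ⟨l, hl, hlξ⟩ : ∃ l : ℝ, 0 < l ∧ l • ξ ∈ Metric.ball (0 : E) r := by
    have h1 : ContinuousAt (fun l : ℝ => l • ξ) 0 := by fun_prop
    have h2 : ∀ᶠ l in 𝓝 (0 : ℝ), l • ξ ∈ Metric.ball (0 : E) r := by
      refine h1.eventually (Metric.isOpen_ball.mem_nhds ?_)
      simpa using hF.pos
    obtain ⟨δ, hδ, hball⟩ := Metric.eventually_nhds_iff_ball.1 h2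
    refine ⟨δ / 2, by positivity, hball _ ?_⟩
    rw [mem_ball_zero_iff, Real.norm_of_nonneg (by positivity)]
    linarith
  obtain ⟨v, hv, hw⟩ := hF.radial ξ l hl hlξ
  choose w hw using hw
  let c : ℝ → E := fun t => F (t • ξ)
  have habs : ∀ {t l : ℝ}, t ∈ Set.Ioo (-l) l ↔ |t| < l := abs_lt.symm
  have hball : ∀ t ∈ Set.Ioo (-l) l, t • ξ ∈ Metric.ball (0 : E) r := fun t ht =>
    smul_mem_ball_of_abs_lt hlξ (habs.1 ht)
  have hcU : ∀ t ∈ Set.Ioo (-l) l, c t ∈ U := fun t ht => hF.mapsTo _ (hball t ht)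
  have hline : ContDiffOn ℝ ∞ (fun t : ℝ => t • ξ) (Set.Ioo (-l) l) := by fun_prop
  have hcs : ContDiffOn ℝ ∞ c (Set.Ioo (-l) l) := hF.contDiffOn.comp hline hball
  have hvs : ContDiffOn ℝ ∞ v (Set.Ioo (-l) l) :=
    ((contDiffOn_infty_iff_deriv_of_isOpen isOpen_Ioo).1 hcs).2.congr fun t ht =>
      (hv t (habs.1 ht)).1.deriv.symm
  have h0l : (0 : ℝ) ∈ Set.Ioo (-l) l := ⟨by linarith, hl⟩
  have hc0 : c 0 = p := by simp [c, hF.map_zero]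
  have hv0 : v 0 = ξ := by
    have h1 : HasDerivAt c ξ 0 := by
      have h2 : HasFDerivAt F (ContinuousLinearMap.id ℝ E) ((0 : ℝ) • ξ) := by
        rw [zero_smul]
        exact hF.hasFDerivAt_zero
      simpa using! h2.comp_hasDerivAt (0 : ℝ) ((hasDerivAt_id (0 : ℝ)).smul_const ξ)
    exact (hv 0 (habs.1 h0l)).1.unique h1
  -- the parallel frame
  have hΓs : ContDiffOn ℝ ∞ (fun t => christoffel G (c t) (v t)) (Set.Ioo (-l) l) :=
    (h.contDiffOn_christoffel.comp hcs hcU).clm_apply hvs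
  obtain ⟨ε, hε, hεl, P, hP0, hPd, hPs⟩ := exists_linear_ode hl hΓs.neg
  have hsub : Set.Ioo (-ε) ε ⊆ Set.Ioo (-l) l := Set.Ioo_subset_Ioo (by linarith) hεl
  have h0ε : (0 : ℝ) ∈ Set.Ioo (-ε) ε := ⟨by linarith, hε⟩
  have hPda : ∀ t ∈ Set.Ioo (-ε) ε, ∀ x,
      HasDerivAt (fun s => P s x) (-christoffel G (c t) (v t) (P t x)) t := by
    intro t ht x
    simpa using (hPd t ht).clm_apply (hasDerivAt_const t x)
  have hiso : ∀ t ∈ Set.Ioo (-ε) ε, ∀ x y, G (c t) (P t x) (P t y) = G p x y := by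
    intro t ht x y
    have hd : ∀ s ∈ Set.Ioo (-ε) ε, HasDerivAt (fun s => G (c s) (P s x) (P s y)) 0 s :=
      fun s hs => h.hasDerivAt_inner_parallel (hcU s (hsub hs)) (hv s (habs.1 (hsub hs))).1
        (hPda s hs x) (hPda s hs y)
    have := isOpen_Ioo.is_const_of_deriv_eq_zero isPreconnected_Ioo
      (fun s hs => (hd s hs).differentiableAt.differentiableWithinAt)
      (fun s hs => (hd s hs).deriv) ht h0ε
    simpa [hP0, hc0] using this
  have hPinv : ∀ t ∈ Set.Ioo (-ε) ε, (P t).IsInvertible := by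
    intro t ht
    have hinj : Function.Injective (P t).toLinearMap := by
      intro x y hxy
      refine h.eq_of_forall_apply_eq hp fun z => ?_
      have hxy' : P t x = P t y := hxy
      rw [← hiso t ht, hxy', hiso t ht]
    refine ⟨(LinearEquiv.ofInjectiveEndo _ hinj).toContinuousLinearEquiv, ?_⟩
    ext x
    rfl
  -- the inverse `S` of the frame
  let S : ℝ → E →L[ℝ] E := fun t => (P t).inverse
  have hSs : ContDiffOn ℝ ∞ S (Set.Ioo (-ε) ε) := fun t ht =>
    ((hPinv t ht).contDiffAt_map_inverse).comp_contDiffWithinAt t (hPs t ht)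
  have hSP : ∀ t ∈ Set.Ioo (-ε) ε, ∀ x, S t (P t x) = x := fun t ht =>
    (hPinv t ht).inverse_apply_self
  have hPS : ∀ t ∈ Set.Ioo (-ε) ε, ∀ x, P t (S t x) = x := fun t ht =>
    (hPinv t ht).self_apply_inverse
  have hSd : ∀ t ∈ Set.Ioo (-ε) ε, HasDerivAt S (S t ∘L christoffel G (c t) (v t)) t := by
    intro t ht
    have h1 : HasDerivAt S (deriv S t) t :=
      ((hSs.contDiffAt (isOpen_Ioo.mem_nhds ht)).differentiableAt (by simp)).hasDerivAt
    refine h1.congr_deriv ?_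
    ext y
    obtain ⟨x, rfl⟩ : ∃ x, y = P t x := ⟨S t y, (hPS t ht y).symm⟩
    have h2 := h1.clm_apply (hPda t ht x)
    have h3 : HasDerivAt (fun s => S s (P s x)) 0 t := by
      refine (hasDerivAt_const t x).congr_of_eventuallyEq ?_
      filter_upwards [isOpen_Ioo.mem_nhds ht] with s hs using hSP s hs x
    have h4 := h2.unique h3
    rw [map_neg, add_neg_eq_zero] at h4
    exact h4
  have hDFs : ContDiffOn ℝ ∞ (fun t : ℝ => fderiv ℝ F (t • ξ)) (Set.Ioo (-ε) ε) :=
    (hF.contDiffOn.fderiv_of_isOpen Metric.isOpen_ball (by simp)).comp (hline.mono hsub)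
      fun t ht => hball t (hsub ht)
  let a : ℝ → E →L[ℝ] E := fun t => S t ∘L fderiv ℝ F (t • ξ)
  have has : ContDiffOn ℝ ∞ a (Set.Ioo (-ε) ε) := hSs.clm_comp hDFs
  let R : ℝ → E →L[ℝ] E := fun t => S t ∘L jacobiEnd G (c t) (v t) ∘L P t
  have hRs : ContDiffOn ℝ ∞ R (Set.Ioo (-ε) ε) :=
    hSs.clm_comp ((h.contDiffOn_jacobiEnd (hcs.mono hsub) (fun t ht => hcU t (hsub ht))
      (hvs.mono hsub)).clm_comp hPs)
  refine ⟨ε, hε, P, a, R, has, hRs, ?_, ?_, hiso, ?_, ?_⟩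
  · have : S 0 = ContinuousLinearMap.id ℝ E := by
      change (P 0).inverse = _
      rw [hP0, ContinuousLinearMap.inverse_id]
    simp only [a, this, zero_smul, hF.hasFDerivAt_zero.fderiv]
    rfl
  · intro t ht η
    exact (hPS t ht _).symm
  · intro t ht
    have hAs : ContDiffOn ℝ ∞ (fun s => s • a s) (Set.Ioo (-ε) ε) := contDiffOn_id.smul has
    have hA's := ((contDiffOn_infty_iff_deriv_of_isOpen isOpen_Ioo).1 hAs).2
    -- the first derivative of `A` applied to `η`
    have hA1 : ∀ η, ∀ s ∈ Set.Ioo (-ε) ε, deriv (fun s => s • a s) s η =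
        S s (w η s + christoffel G (c s) (v s) (s • fderiv ℝ F (s • ξ) η)) := by
      intro η s hs
      have h1 : HasDerivAt (fun s => s • a s) (deriv (fun s => s • a s) s) s :=
        ((hAs.contDiffAt (isOpen_Ioo.mem_nhds hs)).differentiableAt (by simp)).hasDerivAt
      have h2 := h1.clm_apply (hasDerivAt_const s η)
      have h3 := (hSd s hs).clm_apply (hw η s (habs.1 (hsub hs))).1
      have h4 := h2.unique (h3.congr_of_eventuallyEq (by
        refine Filter.Eventually.of_forall fun s' => ?_
        simp [a]))
      simp only [map_zero, add_zero] at h4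
      rw [h4, map_add, ContinuousLinearMap.comp_apply, add_comm]
    ext η
    have h1 : HasDerivAt (deriv fun s => s • a s) (deriv (deriv fun s => s • a s) t) t :=
      ((hA's.contDiffAt (isOpen_Ioo.mem_nhds ht)).differentiableAt (by simp)).hasDerivAt
    have h2 := h1.clm_apply (hasDerivAt_const t η)
    have hv' := hv t (habs.1 (hsub ht))
    have hw' := hw η t (habs.1 (hsub ht))
    have h3 := (hSd t ht).clm_apply
      (h.hasDerivAt_covDeriv_jacobi (hcU t (hsub ht)) hv'.1 hv'.2 hw'.1 hw'.2)
    have h4 := h2.unique (h3.congr_of_eventuallyEq (by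
      filter_upwards [isOpen_Ioo.mem_nhds ht] with s hs using hA1 η s hs))
    simp only [map_zero, add_zero] at h4
    have hR : (-(R t * (t • a t))) η =
        -S t (jacobiEnd G (c t) (v t) (t • fderiv ℝ F (t • ξ) η)) := by
      change -S t (jacobiEnd G (c t) (v t) (P t (t • S t (fderiv ℝ F (t • ξ) η)))) = _
      rw [map_smul (P t), hPS t ht]
    rw [h4, hR, map_sub, map_neg, ContinuousLinearMap.comp_apply, jacobiEnd_apply]
    abel
  · intro k η ζ
    let Λ : (E →L[ℝ] E) →L[ℝ] ℝ := (G p).flip ζ ∘L ContinuousLinearMap.apply ℝ E η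
    have hΛ : ∀ B : E →L[ℝ] E, Λ B = G p (B η) ζ := fun B => rfl
    have key : ∀ k, ∀ t ∈ Set.Ioo (-ε) ε, iteratedDeriv k (fun s => Λ (R s)) t =
        jacobiForm G (c t) k (v t) (P t η) (P t ζ) := by
      intro k
      induction k with
      | zero =>
        intro t ht
        rw [iteratedDeriv_zero, hΛ, ← hiso t ht]
        simp only [R, ContinuousLinearMap.comp_apply, hPS t ht, jacobiEnd_apply]
        rfl
      | succ k ih =>
        intro t ht
        have hv' := hv t (habs.1 (hsub ht))
        have h1 := h.hasDerivAt_covDerivCurvature_parallel (hcU t (hsub ht)) hv'.1 hv'.2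
          (hPda t ht η) (hPda t ht ζ) k
        rw [iteratedDeriv_succ, ← h1.deriv]
        refine Filter.EventuallyEq.deriv_eq ?_
        filter_upwards [isOpen_Ioo.mem_nhds ht] with s hs using ih s hs
    have h1 := key k 0 h0ε
    rw [hP0, hc0, hv0] at h1
    have h2 : iteratedDeriv k (fun s => Λ (R s)) 0 = Λ (iteratedDeriv k R 0) := by
      have hR0 : ContDiffAt ℝ k R 0 :=
        (hRs.contDiffAt (isOpen_Ioo.mem_nhds h0ε)).of_le (by exact_mod_cast le_top)
      rw [iteratedDeriv_eq_iteratedFDeriv, iteratedDeriv_eq_iteratedFDeriv]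
      exact congrArg (fun T : ContinuousMultilinearMap ℝ (fun _ : Fin k => ℝ) ℝ => T fun _ => 1)
        (Λ.iteratedFDeriv_comp_left hR0 le_rfl)
    rw [← hΛ, ← h2, h1]
    rfl

end Jacobi

/-! ### The recursion for the Taylor coefficients -/

section Recursion

open Finset

variable {A : Type*} [Ring A] [Algebra ℝ A]

/-- The first coefficients of the solution `U = ∑ uₙ tⁿ` of the Riccati equation
`t U' + 2 U + t R + t U² = 0`, where `R = ∑ (tⁿ / n!) Jₙ`. -/
theorem riccati_coeff {u J : ℕ → A} (hu0 : u 0 = 0)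
    (hu : ∀ n : ℕ, ((n : ℝ) + 3) • u (n + 1) =
      -((n.factorial : ℝ)⁻¹ • J n + ∑ ij ∈ antidiagonal n, u ij.1 * u ij.2)) :
    u 1 = (-1 / 3 : ℝ) • J 0 ∧ u 2 = (-1 / 4 : ℝ) • J 1 ∧
    u 3 = (-1 / 10 : ℝ) • J 2 + (-1 / 45 : ℝ) • (J 0 * J 0) ∧
    u 4 = (-1 / 36 : ℝ) • J 3 + (-1 / 72 : ℝ) • (J 0 * J 1) + (-1 / 72 : ℝ) • (J 1 * J 0) ∧
    u 5 = (-1 / 168 : ℝ) • J 4 + (-1 / 210 : ℝ) • (J 0 * J 2) + (-2 / 945 : ℝ) • (J 0 * J 0 * J 0)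
      + (-1 / 112 : ℝ) • (J 1 * J 1) + (-1 / 210 : ℝ) • (J 2 * J 0) := by
  have solve : ∀ n : ℕ, u (n + 1) = (-((n : ℝ) + 3)⁻¹) • ((n.factorial : ℝ)⁻¹ • J n +
      ∑ i ∈ range (n + 1), u i * u (n - i)) := by
    intro n
    have hn : ((n : ℝ) + 3) ≠ 0 := by positivity
    rw [neg_smul, ← smul_neg, eq_inv_smul_iff₀ hn, hu n,
      Nat.sum_antidiagonal_eq_sum_range_succ fun i j => u i * u j]
  have h1 : u 1 = (-1 / 3 : ℝ) • J 0 := by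
    rw [solve 0]
    simp [hu0]
    module
  have h2 : u 2 = (-1 / 4 : ℝ) • J 1 := by
    rw [solve 1]
    simp [sum_range_succ, hu0]
    module
  have h3 : u 3 = (-1 / 10 : ℝ) • J 2 + (-1 / 45 : ℝ) • (J 0 * J 0) := by
    rw [solve 2]
    simp [sum_range_succ, hu0, h1, Nat.factorial]
    module
  have h4 : u 4 = (-1 / 36 : ℝ) • J 3 + (-1 / 72 : ℝ) • (J 0 * J 1)
      + (-1 / 72 : ℝ) • (J 1 * J 0) := by
    rw [solve 3]
    simp [sum_range_succ, hu0, h1, h2, Nat.factorial]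
    module
  refine ⟨h1, h2, h3, h4, ?_⟩
  rw [solve 4]
  simp [sum_range_succ, hu0, h1, h2, h3, Nat.factorial, mul_add, add_mul, mul_assoc]
  module

/-- The power series `∑ dₙ tⁿ` with `D' = D · τ(U)`, `D(0) = 1`, where `U` solves the Riccati
equation of `riccati_coeff` and `τ` is a trace. -/
theorem density_coeff {u J : ℕ → A} (τ : A →ₗ[ℝ] ℝ) (hτ : ∀ x y, τ (x * y) = τ (y * x))
    (hu0 : u 0 = 0)
    (hu : ∀ n : ℕ, ((n : ℝ) + 3) • u (n + 1) =
      -((n.factorial : ℝ)⁻¹ • J n + ∑ ij ∈ antidiagonal n, u ij.1 * u ij.2))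
    {d : ℕ → ℝ} (hd0 : d 0 = 1)
    (hd : ∀ n : ℕ, ((n : ℝ) + 1) * d (n + 1) = ∑ ij ∈ antidiagonal n, d ij.1 * τ (u ij.2)) :
    d 1 = 0 ∧
    d 2 = -τ (J 0) / 6 ∧
    d 3 = -τ (J 1) / 12 ∧
    d 4 = τ (J 0) ^ 2 / 72 - τ (J 0 ^ 2) / 180 - τ (J 2) / 40 ∧
    d 5 = τ (J 0) * τ (J 1) / 72 - τ (J 0 * J 1) / 180 - τ (J 3) / 180 ∧
    d 6 = -τ (J 0) ^ 3 / 1296 + τ (J 0) * τ (J 0 ^ 2) / 1080 + τ (J 0) * τ (J 2) / 240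
      - τ (J 0 ^ 3) / 2835 - τ (J 0 * J 2) / 630 + τ (J 1) ^ 2 / 288
      - τ (J 1 ^ 2) / 672 - τ (J 4) / 1008 ∧
    d 7 = τ (J 0) * τ (J 0 * J 1) / 1080 - τ (J 0) ^ 2 * τ (J 1) / 864 - τ (J 5) / 6720
      + τ (J 0) * τ (J 3) / 1080 + τ (J 0 ^ 2) * τ (J 1) / 2160
      - τ (J 0 ^ 2 * J 1) / 1890 - τ (J 0 * J 3) / 3024 + τ (J 1) * τ (J 2) / 480
      - τ (J 1 * J 2) / 1120 ∧
    d 8 = τ (J 0) ^ 4 / 31104 - τ (J 0) ^ 2 * τ (J 0 ^ 2) / 12960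
      - τ (J 0) ^ 2 * τ (J 2) / 2880
      + τ (J 0) * τ (J 0 ^ 3) / 17010 + τ (J 0) * τ (J 0 * J 2) / 3780
      - τ (J 6) / 51840
      - τ (J 0) * τ (J 1) ^ 2 / 1728 + τ (J 0) * τ (J 1 ^ 2) / 4032
      - τ (J 2 ^ 2) / 7200 + τ (J 0) * τ (J 4) / 6048
      + τ (J 0 ^ 2) * τ (J 2) / 7200
      + τ (J 0 ^ 2) ^ 2 / 64800 - τ (J 0 ^ 4) / 37800
      - 17 * τ (J 0 ^ 2 * J 2) / 113400
      + τ (J 0 * J 1) * τ (J 1) / 2160 - 5 * τ (J 0 * J 1 ^ 2) / 18144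
      - τ (J 0 * J 4) / 18144
      + τ (J 1) * τ (J 3) / 2160 - τ (J 1 * J 3) / 5184
      + τ (J 2) ^ 2 / 3200 := by
  obtain ⟨h1, h2, h3, h4, h5⟩ := riccati_coeff hu0 hu
  have p2 : ∀ x : A, x ^ 2 = x * x := fun x => pow_two x
  have p3 : ∀ x : A, x ^ 3 = x * (x * x) := fun x => by rw [pow_succ', pow_two]
  have p4 : ∀ x : A, x ^ 4 = x * (x * (x * x)) := fun x => by rw [pow_succ', p3]
  -- traces of words are determined by the cyclic words
  have c10 := hτ (J 1) (J 0)
  have c20 := hτ (J 2) (J 0)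
  have c21 := hτ (J 2) (J 1)
  have c30 := hτ (J 3) (J 0)
  have c31 := hτ (J 3) (J 1)
  have c40 := hτ (J 4) (J 0)
  have c100 : τ (J 1 * (J 0 * J 0)) = τ (J 0 * (J 0 * J 1)) := by
    rw [hτ, mul_assoc]
  have c010 : τ (J 0 * (J 1 * J 0)) = τ (J 0 * (J 0 * J 1)) := by
    rw [hτ (J 0) (J 1 * J 0), mul_assoc, c100]
  have c020 : τ (J 0 * (J 2 * J 0)) = τ (J 0 * (J 0 * J 2)) := by
    rw [hτ (J 0) (J 2 * J 0), mul_assoc, hτ (J 2) (J 0 * J 0), mul_assoc]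
  have c200 : τ (J 2 * (J 0 * J 0)) = τ (J 0 * (J 0 * J 2)) := by
    rw [hτ, mul_assoc]
  have c101 : τ (J 1 * (J 0 * J 1)) = τ (J 0 * (J 1 * J 1)) := by
    rw [hτ, mul_assoc]
  have c110 : τ (J 1 * (J 1 * J 0)) = τ (J 0 * (J 1 * J 1)) := by
    rw [← mul_assoc, hτ]
  have t1 : τ (u 1) = -τ (J 0) / 3 := by
    rw [h1]; simp; ring
  have t2 : τ (u 2) = -τ (J 1) / 4 := by
    rw [h2]; simp; ring
  have t3 : τ (u 3) = -τ (J 2) / 10 - τ (J 0 * J 0) / 45 := by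
    rw [h3]; simp; ring
  have t4 : τ (u 4) = -τ (J 3) / 36 - τ (J 0 * J 1) / 36 := by
    rw [h4]; simp [c10]; ring
  have t5 : τ (u 5) = -τ (J 4) / 168 - τ (J 0 * J 2) / 105 - 2 * τ (J 0 * (J 0 * J 0)) / 945
      - τ (J 1 * J 1) / 112 := by
    rw [h5]; simp [c20, mul_assoc]; ring
  have ht : ∀ n : ℕ, ((n : ℝ) + 3) * τ (u (n + 1)) = -((n.factorial : ℝ)⁻¹ * τ (J n) +
      ∑ i ∈ range (n + 1), τ (u i * u (n - i))) := by
    intro n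
    have := congrArg τ (hu n)
    rw [Nat.sum_antidiagonal_eq_sum_range_succ fun i j => u i * u j] at this
    simpa using this
  have t6 : τ (u 6) = -τ (J 5) / 960 - (2 * τ (u 1 * u 4) + 2 * τ (u 2 * u 3)) / 8 := by
    have := ht 5
    simp [sum_range_succ, hu0, Nat.factorial, hτ (u 4) (u 1), hτ (u 3) (u 2)] at this
    linarith
  have t7 : τ (u 7) = -τ (J 6) / 6480 - (2 * τ (u 1 * u 5) + 2 * τ (u 2 * u 4) + τ (u 3 * u 3)) / 9 := by
    have := ht 6
    simp [sum_range_succ, hu0, Nat.factorial, hτ (u 5) (u 1), hτ (u 4) (u 2)] at this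
    linarith
  have hd' : ∀ n : ℕ, d (n + 1) = ((n : ℝ) + 1)⁻¹ * ∑ i ∈ range (n + 1), d i * τ (u (n - i)) := by
    intro n
    have hn : ((n : ℝ) + 1) ≠ 0 := by positivity
    rw [← Nat.sum_antidiagonal_eq_sum_range_succ fun i j => d i * τ (u j), ← hd n,
      inv_mul_cancel_left₀ hn]
  have t6' : τ (u 6) = -τ (J 5) / 960 - τ (J 0 * J 3) / 432 - τ (J 0 * (J 0 * J 1)) / 270
      - τ (J 1 * J 2) / 160 := by
    rw [t6, h1, h2, h3, h4]
    simp [mul_add, c010, c100]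
    ring
  have t7' : τ (u 7) = -τ (J 6) / 6480 - τ (J 0 * J 4) / 2268
      - 17 * τ (J 0 * (J 0 * J 2)) / 14175 - τ (J 0 * (J 0 * (J 0 * J 0))) / 4725
      - 5 * τ (J 0 * (J 1 * J 1)) / 2268 - τ (J 1 * J 3) / 648 - τ (J 2 * J 2) / 900 := by
    rw [t7, h1, h2, h3, h4, h5]
    simp [mul_add, add_mul, mul_assoc, c020, c200, c101, c110]
    ring
  have d1 : d 1 = 0 := by
    rw [hd' 0]; simp [hu0]
  have d2 : d 2 = -τ (J 0) / 6 := by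
    rw [hd' 1]; simp [sum_range_succ, hu0, hd0, t1]; ring
  have d3 : d 3 = -τ (J 1) / 12 := by
    rw [hd' 2]; simp [sum_range_succ, hu0, hd0, d1, t2]; ring
  have d4 : d 4 = τ (J 0) ^ 2 / 72 - τ (J 0 * J 0) / 180 - τ (J 2) / 40 := by
    rw [hd' 3]; simp [sum_range_succ, hu0, hd0, d1, d2, t1, t3]; ring
  have d5 : d 5 = τ (J 0) * τ (J 1) / 72 - τ (J 0 * J 1) / 180 - τ (J 3) / 180 := by
    rw [hd' 4]; simp [sum_range_succ, hu0, hd0, d1, d2, d3, t1, t2, t4]; ring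
  have d6 : d 6 = -τ (J 0) ^ 3 / 1296 + τ (J 0) * τ (J 0 * J 0) / 1080
      + τ (J 0) * τ (J 2) / 240 - τ (J 0 * (J 0 * J 0)) / 2835 - τ (J 0 * J 2) / 630
      + τ (J 1) ^ 2 / 288 - τ (J 1 * J 1) / 672 - τ (J 4) / 1008 := by
    rw [hd' 5]; simp [sum_range_succ, hu0, hd0, d1, d2, d3, d4, t1, t2, t3, t5]; ring
  simp only [p2, p3, p4, mul_assoc]
  refine ⟨d1, d2, d3, ?_, d5, ?_, ?_, ?_⟩
  · exact d4
  · exact d6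
  · rw [hd' 6]
    simp [sum_range_succ, hu0, hd0, d1, d2, d3, d4, d5, t1, t2, t3, t4, t6']
    ring
  · rw [hd' 7]
    simp [sum_range_succ, hu0, hd0, d1, d2, d3, d4, d5, d6, t1, t2, t3, t4, t5, t7']
    ring

end Recursion

/-! ### Taylor coefficients of functions of one variable -/

section TaylorCoefficients

open Finset

/-- The `n`-th Taylor coefficient at `0`. -/
def taylorCoeff {V : Type*} [NormedAddCommGroup V] [NormedSpace ℝ V] (f : ℝ → V) (n : ℕ) : V :=
  (n.factorial : ℝ)⁻¹ • iteratedDeriv n f 0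

section Module

variable {V W : Type*} [NormedAddCommGroup V] [NormedSpace ℝ V] [NormedAddCommGroup W]
  [NormedSpace ℝ W]

theorem taylorCoeff_zero (f : ℝ → V) : taylorCoeff f 0 = f 0 := by
  simp [taylorCoeff]

theorem taylorCoeff_congr {f g : ℝ → V} (h : f =ᶠ[𝓝 0] g) (n : ℕ) :
    taylorCoeff f n = taylorCoeff g n := by
  rw [taylorCoeff, taylorCoeff, (h.iteratedDeriv n).eq_of_nhds]

theorem taylorCoeff_deriv (f : ℝ → V) (n : ℕ) :
    taylorCoeff (deriv f) n = ((n : ℝ) + 1) • taylorCoeff f (n + 1) := by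
  have h : ((n : ℝ) + 1) ≠ 0 := by positivity
  rw [taylorCoeff, taylorCoeff, iteratedDeriv_succ', smul_smul, Nat.factorial_succ]
  congr 1
  push_cast
  rw [mul_inv, mul_inv_cancel_left₀ h]

theorem taylorCoeff_add {f g : ℝ → V} (hf : ContDiffAt ℝ ∞ f 0) (hg : ContDiffAt ℝ ∞ g 0)
    (n : ℕ) : taylorCoeff (f + g) n = taylorCoeff f n + taylorCoeff g n := by
  rw [taylorCoeff, taylorCoeff, taylorCoeff, iteratedDeriv_add (contDiffAt_infty.1 hf n)
    (contDiffAt_infty.1 hg n), smul_add]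

theorem taylorCoeff_clm_comp (L : V →L[ℝ] W) {f : ℝ → V} (hf : ContDiffAt ℝ ∞ f 0) (n : ℕ) :
    taylorCoeff (fun t => L (f t)) n = L (taylorCoeff f n) := by
  rw [taylorCoeff, taylorCoeff, map_smul, iteratedDeriv_eq_iteratedFDeriv,
    iteratedDeriv_eq_iteratedFDeriv]
  exact congrArg (fun T : ContinuousMultilinearMap ℝ (fun _ : Fin n => ℝ) W =>
    (n.factorial : ℝ)⁻¹ • T fun _ => 1)
    (L.iteratedFDeriv_comp_left (contDiffAt_infty.1 hf n) le_rfl)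

end Module

section Algebra

variable {A : Type*} [NormedRing A] [NormedAlgebra ℝ A]

theorem taylorCoeff_mul {f g : ℝ → A} (hf : ContDiffAt ℝ ∞ f 0) (hg : ContDiffAt ℝ ∞ g 0)
    (n : ℕ) : taylorCoeff (f * g) n =
      ∑ ij ∈ antidiagonal n, taylorCoeff f ij.1 * taylorCoeff g ij.2 := by
  rw [Nat.sum_antidiagonal_eq_sum_range_succ fun i j => taylorCoeff f i * taylorCoeff g j,
    taylorCoeff, iteratedDeriv_mul (contDiffAt_infty.1 hf n) (contDiffAt_infty.1 hg n), smul_sum]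
  refine sum_congr rfl fun i hi => ?_
  have hin : i ≤ n := Nat.lt_succ_iff.1 (mem_range.1 hi)
  rw [taylorCoeff, taylorCoeff, smul_mul_smul_comm, mul_assoc, ← nsmul_eq_mul,
    ← Nat.cast_smul_eq_nsmul ℝ, smul_smul]
  congr 1
  rw [Nat.cast_choose ℝ hin]
  have h1 : (n.factorial : ℝ) ≠ 0 := by positivity
  field_simp

theorem taylorCoeff_id_smul {f : ℝ → A} (hf : ContDiffAt ℝ ∞ f 0) (n : ℕ) :
    taylorCoeff (fun t => t • f t) (n + 1) = taylorCoeff f n := by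
  have hid : ContDiffAt ℝ ∞ (fun t : ℝ => algebraMap ℝ A t) 0 :=
    (Algebra.linearMap ℝ A).toAddMonoidHom.toRealLinearMap
      (continuous_algebraMap ℝ A) |>.contDiff.contDiffAt
  have h1 : (fun t : ℝ => t • f t) = (fun t : ℝ => algebraMap ℝ A t) * f := by
    funext t
    simp [Algebra.smul_def]
  have hd : deriv (fun t : ℝ => algebraMap ℝ A t) = fun _ => 1 := by
    funext t
    have : HasDerivAt (fun t : ℝ => t • (1 : A)) ((1 : ℝ) • (1 : A)) t :=
      (hasDerivAt_id t).smul_const 1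
    simpa [Algebra.algebraMap_eq_smul_one] using this.deriv
  have h0 : taylorCoeff (fun t : ℝ => algebraMap ℝ A t) 0 = 0 := by simp [taylorCoeff]
  have h1' : taylorCoeff (fun t : ℝ => algebraMap ℝ A t) 1 = 1 := by
    simp [taylorCoeff, iteratedDeriv_succ', hd]
  have h2 : ∀ k, taylorCoeff (fun t : ℝ => algebraMap ℝ A t) (k + 2) = 0 := by
    intro k
    rw [taylorCoeff, iteratedDeriv_succ', iteratedDeriv_succ', hd]
    simp
  rw [h1, taylorCoeff_mul hid hf, Nat.sum_antidiagonal_succ, h0, zero_mul, zero_add]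
  cases n with
  | zero => simp [h1']
  | succ n =>
    rw [Nat.sum_antidiagonal_succ, zero_add, h1', one_mul]
    simp [h2]

end Algebra

end TaylorCoefficients

/-! ### The determinant of a solution of the Jacobi equation -/

section Determinant

variable {E : Type*} [NormedAddCommGroup E] [NormedSpace ℝ E] [FiniteDimensional ℝ E]

theorem contDiff_det {n : WithTop ℕ∞} :
    ContDiff ℝ n fun f : E →L[ℝ] E => LinearMap.det (f : E →ₗ[ℝ] E) := by
  let b := Module.finBasis ℝ E
  have h : (fun f : E →L[ℝ] E => LinearMap.det (f : E →ₗ[ℝ] E)) = fun f : E →L[ℝ] E =>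
      (LinearMap.toMatrix b b (f : E →ₗ[ℝ] E)).det := by
    funext f
    rw [LinearMap.det_toMatrix]
  rw [h]
  simp only [Matrix.det_apply']
  refine ContDiff.sum fun σ _ => contDiff_const.mul (contDiff_prod fun i _ => ?_)
  simp only [LinearMap.toMatrix_apply]
  let L : (E →L[ℝ] E) →L[ℝ] ℝ :=
    LinearMap.toContinuousLinearMap (b.coord (σ i)) ∘L ContinuousLinearMap.apply ℝ E (b i)
  exact L.contDiff

/-- The trace, as a continuous functional. -/
def traceCLM : (E →L[ℝ] E) →L[ℝ] ℝ :=
  LinearMap.toContinuousLinearMap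
    (LinearMap.trace ℝ E ∘ₗ ContinuousLinearMap.coeLM ℝ)

theorem traceCLM_apply (f : E →L[ℝ] E) : traceCLM f = LinearMap.trace ℝ E (f : E →ₗ[ℝ] E) := rfl

theorem traceCLM_mul_comm (f g : E →L[ℝ] E) : traceCLM (f * g) = traceCLM (g * f) :=
  LinearMap.trace_mul_comm ℝ (f : E →ₗ[ℝ] E) (g : E →ₗ[ℝ] E)

/-- The derivative of the determinant at the identity is the trace. -/
theorem hasFDerivAt_det_one :
    HasFDerivAt (fun f : E →L[ℝ] E => LinearMap.det (f : E →ₗ[ℝ] E)) traceCLM 1 := by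
  have h1 : HasFDerivAt (fun f : E →L[ℝ] E => LinearMap.det (f : E →ₗ[ℝ] E)) _ 1 :=
    ((contDiff_det (n := 1)).differentiable (by simp) 1).hasFDerivAt
  refine h1.congr_fderiv ?_
  ext B
  have hl : HasDerivAt (fun s : ℝ => (1 : E →L[ℝ] E) + s • B) B 0 := by
    simpa using ((hasDerivAt_id (0 : ℝ)).smul_const B).const_add (1 : E →L[ℝ] E)
  have h1' : HasFDerivAt (fun f : E →L[ℝ] E => LinearMap.det (f : E →ₗ[ℝ] E))
      (fderiv ℝ (fun f : E →L[ℝ] E => LinearMap.det (f : E →ₗ[ℝ] E)) 1)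
      ((1 : E →L[ℝ] E) + (0 : ℝ) • B) := by simpa using h1
  have h2 := h1'.comp_hasDerivAt (0 : ℝ) hl
  refine h2.unique ?_
  let b := Module.finBasis ℝ E
  let M := LinearMap.toMatrix b b (B : E →ₗ[ℝ] E)
  have h3 : ∀ s : ℝ, LinearMap.det (((1 : E →L[ℝ] E) + s • B : E →L[ℝ] E) : E →ₗ[ℝ] E) =
      (1 + s • M).det := by
    intro s
    rw [← LinearMap.det_toMatrix b]
    congr 1
    simp [M, LinearMap.toMatrix_one]
  let q : Polynomial ℝ :=
    (1 + (Polynomial.X : Polynomial ℝ) • M.map ⇑Polynomial.C).det.divX.divX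
  have h4 : (fun s : ℝ => LinearMap.det (((1 : E →L[ℝ] E) + s • B : E →L[ℝ] E) : E →ₗ[ℝ] E)) =
      fun s => 1 + M.trace * s + q.eval s * s ^ 2 := by
    funext s
    rw [h3, Matrix.det_one_add_smul]
  have h5 := (((hasDerivAt_id (0 : ℝ)).const_mul M.trace).const_add 1).add
    ((q.hasDerivAt 0).mul ((hasDerivAt_id (0 : ℝ)).pow 2))
  have h6 : traceCLM B = M.trace := (LinearMap.trace_eq_matrix_trace ℝ b (B : E →ₗ[ℝ] E))
  rw [h6]
  change HasDerivAt
    (fun s : ℝ => LinearMap.det (((1 : E →L[ℝ] E) + s • B : E →L[ℝ] E) : E →ₗ[ℝ] E)) _ 0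
  rw [h4]
  simpa using! h5

/-- **Jacobi's formula** `(det a)' = det a · Tr(a' a⁻¹)`. -/
theorem hasDerivAt_det {a : ℝ → E →L[ℝ] E} {a' b : E →L[ℝ] E} {t : ℝ} (ha : HasDerivAt a a' t)
    (hab : a t * b = 1) :
    HasDerivAt (fun s => LinearMap.det (a s : E →ₗ[ℝ] E))
      (LinearMap.det (a t : E →ₗ[ℝ] E) * traceCLM (a' * b)) t := by
  have h1 : HasDerivAt (fun s => a s * b) (a' * b) t := ha.mul_const b
  have h2 : HasFDerivAt (fun f : E →L[ℝ] E => LinearMap.det (f : E →ₗ[ℝ] E)) traceCLM (a t * b) := by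
    rw [hab]
    exact hasFDerivAt_det_one
  have h3 := (h2.comp_hasDerivAt t h1).const_mul (LinearMap.det (a t : E →ₗ[ℝ] E))
  have h4 : LinearMap.det (b : E →ₗ[ℝ] E) * LinearMap.det (a t : E →ₗ[ℝ] E) = 1 := by
    have := congrArg (fun f : E →L[ℝ] E => LinearMap.det (f : E →ₗ[ℝ] E)) hab
    simp only [ContinuousLinearMap.toLinearMap_mul, map_mul, ContinuousLinearMap.toLinearMap_one, map_one] at this
    rw [mul_comm]
    exact this
  refine h3.congr_of_eventuallyEq (Filter.Eventually.of_forall fun s => ?_)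
  simp only [Function.comp_apply, ContinuousLinearMap.toLinearMap_mul, map_mul]
  rw [mul_comm (LinearMap.det (a s : E →ₗ[ℝ] E)), ← mul_assoc, mul_comm (LinearMap.det (a t : E →ₗ[ℝ] E)),
    h4, one_mul]

/-- If `A = t a` solves the Jacobi equation `A'' + R A = 0` with `a(0) = 1`, then the Taylor
coefficients of `U = a' a⁻¹` satisfy the recursion obtained from the Riccati equation
`t U' + 2 U + t R + t U² = 0`, and those of `D = det a` the one obtained from `D' = D Tr U`. -/
theorem exists_riccati_coeff {a R : ℝ → E →L[ℝ] E} (ha : ContDiffAt ℝ ∞ a 0)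
    (hR : ContDiffAt ℝ ∞ R 0) (ha0 : a 0 = 1)
    (hJ : ∀ᶠ t in 𝓝 (0 : ℝ), deriv (deriv fun s => s • a s) t = -(R t * (t • a t))) :
    ∃ u : ℕ → E →L[ℝ] E, u 0 = 0 ∧
      (∀ n : ℕ, ((n : ℝ) + 3) • u (n + 1) = -((n.factorial : ℝ)⁻¹ • iteratedDeriv n R 0 +
        ∑ ij ∈ Finset.HasAntidiagonal.antidiagonal n, u ij.1 * u ij.2)) ∧
      ∀ n : ℕ, ((n : ℝ) + 1) * taylorCoeff (fun t => LinearMap.det (a t : E →ₗ[ℝ] E)) (n + 1) =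
        ∑ ij ∈ Finset.HasAntidiagonal.antidiagonal n,
          taylorCoeff (fun t => LinearMap.det (a t : E →ₗ[ℝ] E)) ij.1 * traceCLM (u ij.2) := by
  let b : ℝ → E →L[ℝ] E := fun t => (a t).inverse
  have hinv0 : (a 0).IsInvertible := by
    rw [ha0]
    exact ⟨ContinuousLinearEquiv.refl ℝ E, rfl⟩
  have hb : ContDiffAt ℝ ∞ b 0 := hinv0.contDiffAt_map_inverse.comp 0 ha
  have hinv : ∀ᶠ t in 𝓝 (0 : ℝ), (a t).IsInvertible := by
    have hn := ContinuousLinearEquiv.nhds (ContinuousLinearEquiv.refl ℝ E)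
    have h1 : ((ContinuousLinearEquiv.refl ℝ E : E ≃L[ℝ] E) : E →L[ℝ] E) = a 0 := ha0.symm
    rw [h1] at hn
    exact ha.continuousAt.eventually hn
  have hab : ∀ᶠ t in 𝓝 (0 : ℝ), a t * b t = 1 := hinv.mono fun t ht => ht.self_comp_inverse
  have hba : ∀ᶠ t in 𝓝 (0 : ℝ), b t * a t = 1 := hinv.mono fun t ht => ht.inverse_comp_self
  have hderiv : ∀ {f : ℝ → E →L[ℝ] E}, ContDiffAt ℝ ∞ f 0 →
      ContDiffAt ℝ ∞ (deriv f) 0 ∧ ∀ᶠ t in 𝓝 (0 : ℝ), HasDerivAt f (deriv f t) t := by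
    intro f hf
    refine ⟨?_, ?_⟩
    · exact hf.fderiv_right (m := ∞) (by simp) |>.clm_apply contDiffAt_const
    · filter_upwards [(contDiffAt_infty.1 hf 1).eventually (by simp)] with t ht
      exact (ht.differentiableAt (by simp)).hasDerivAt
  obtain ⟨ha', had⟩ := hderiv ha
  obtain ⟨ha'', ha'd⟩ := hderiv ha'
  let U : ℝ → E →L[ℝ] E := deriv a * b
  have hU : ContDiffAt ℝ ∞ U 0 := ha'.mul hb
  obtain ⟨hU', hUd⟩ := hderiv hU
  have hUa : ∀ᶠ t in 𝓝 (0 : ℝ), U t * a t = deriv a t := by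
    filter_upwards [hba] with t ht
    change deriv a t * b t * a t = deriv a t
    rw [mul_assoc, ht, mul_one]
  -- the Riccati equation
  have hric : ∀ᶠ t in 𝓝 (0 : ℝ), t • (deriv U + R + U * U) t + (U t + U t) = 0 := by
    have hA1 : ∀ᶠ t in 𝓝 (0 : ℝ), deriv (fun s => s • a s) t = a t + t • deriv a t := by
      filter_upwards [had] with t ht
      have := ((hasDerivAt_id t).smul ht).deriv
      simpa [add_comm] using! this
    filter_upwards [had, ha'd, hUd, hUa.eventually_nhds, hA1.eventually_nhds, hJ, hab]
      with t h1 h2 h3 h4 h5 h6 h7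
    have h4' := h4.self_of_nhds
    have e1 : deriv U t * a t + U t * deriv a t = deriv (deriv a) t :=
      (h3.mul h1).unique (h2.congr_of_eventuallyEq h4)
    have e2 : deriv a t + (deriv a t + t • deriv (deriv a) t) = -(R t * (t • a t)) := by
      have h8 := (h1.add ((hasDerivAt_id t).smul h2)).congr_of_eventuallyEq h5
      rw [← h6, h8.deriv]
      simp [add_comm]
    have e3 : (t • (deriv U + R + U * U) t + (U t + U t)) * a t = 0 := by
      simp only [Pi.add_apply, Pi.mul_apply, add_mul, smul_mul_assoc, mul_assoc, h4']
      rw [← e1, mul_smul_comm] at e2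
      rw [← sub_eq_zero] at e2
      rw [← e2]
      module
    have e4 := congrArg (fun X => X * b t) e3
    simpa only [mul_assoc, h7, mul_one, zero_mul] using e4
  have hsum : ContDiffAt ℝ ∞ (deriv U + R + U * U) 0 := (hU'.add hR).add (hU.mul hU)
  have hcoef : ∀ n, taylorCoeff (fun t : ℝ => t • (deriv U + R + U * U) t) n +
      (taylorCoeff U n + taylorCoeff U n) = 0 := by
    intro n
    have h1 : ContDiffAt ℝ ∞ (fun t : ℝ => t • (deriv U + R + U * U) t) 0 :=
      contDiffAt_id.smul hsum
    have h2 : ContDiffAt ℝ ∞ (U + U) 0 := hU.add hU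
    rw [← taylorCoeff_add hU hU, ← taylorCoeff_add h1 h2]
    refine (taylorCoeff_congr (g := fun _ => 0) hric n).trans ?_
    simp [taylorCoeff]
  refine ⟨taylorCoeff U, ?_, fun n => ?_, fun n => ?_⟩
  · have h1 := hcoef 0
    rw [taylorCoeff_zero, zero_smul, zero_add, ← two_smul ℝ, smul_eq_zero] at h1
    exact h1.resolve_left two_ne_zero
  · have h1 := hcoef (n + 1)
    have h2 : ContDiffAt ℝ ∞ (deriv U + R) 0 := hU'.add hR
    have h3 : ContDiffAt ℝ ∞ (U * U) 0 := hU.mul hU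
    rw [taylorCoeff_id_smul hsum, taylorCoeff_add h2 h3,
      taylorCoeff_add hU' hR, taylorCoeff_deriv, taylorCoeff_mul hU hU] at h1
    rw [eq_neg_iff_add_eq_zero, ← h1, taylorCoeff.eq_1 R]
    module
  · have hdet : ContDiffAt ℝ ∞ (fun t => LinearMap.det (a t : E →ₗ[ℝ] E)) 0 :=
      contDiff_det.contDiffAt.comp (0 : ℝ) ha
    have htr : ContDiffAt ℝ ∞ (fun t => traceCLM (U t)) 0 :=
      (traceCLM (E := E)).contDiff.contDiffAt.comp (0 : ℝ) hU
    have h1 : deriv (fun t => LinearMap.det (a t : E →ₗ[ℝ] E)) =ᶠ[𝓝 0]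
        (fun t => LinearMap.det (a t : E →ₗ[ℝ] E)) * fun t => traceCLM (U t) := by
      filter_upwards [had, hab] with t h2 h3
      exact (hasDerivAt_det h2 h3).deriv
    rw [← smul_eq_mul, ← taylorCoeff_deriv, taylorCoeff_congr h1, taylorCoeff_mul hdet htr]
    exact Finset.sum_congr rfl fun ij _ => by rw [taylorCoeff_clm_comp traceCLM hU]

end Determinant

/-! ### The volume density in normal coordinates -/

section Density

universe u

/-- The homogeneous parts of the Taylor series are the Taylor coefficients along rays. -/
theorem taylorTerm_eq_taylorCoeff {E : Type*} [NormedAddCommGroup E] [NormedSpace ℝ E]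
    {f : E → ℝ} (hf : ContDiffAt ℝ ∞ f 0) (k : ℕ) (ξ : E) :
    taylorTerm f k ξ = taylorCoeff (fun t : ℝ => f (t • ξ)) k := by
  obtain ⟨s, hs, h0, hfs⟩ := (contDiffAt_infty.1 hf k).contDiffWithinAt.contDiffOn' le_rfl (by simp)
  rw [Set.insert_eq_of_mem (Set.mem_univ _), Set.univ_inter] at hfs
  let L : ℝ →L[ℝ] E := (ContinuousLinearMap.id ℝ ℝ).smulRight ξ
  have hL : IsOpen (L ⁻¹' s) := hs.preimage L.continuous
  have hL0 : L 0 = 0 := map_zero L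
  have h0' : (0 : ℝ) ∈ L ⁻¹' s := by simpa [hL0] using h0
  have h1 := L.iteratedFDerivWithin_comp_right hfs hs.uniqueDiffOn hL.uniqueDiffOn
    (x := 0) (by rwa [hL0]) le_rfl
  rw [iteratedFDerivWithin_of_isOpen k hL h0', hL0, iteratedFDerivWithin_of_isOpen k hs h0] at h1
  have h2 : (fun t : ℝ => f (t • ξ)) = f ∘ L := by
    funext t
    simp [L]
  rw [taylorTerm, taylorCoeff, iteratedDeriv_eq_iteratedFDeriv, h2, h1, smul_eq_mul]
  simp [L]

variable {E : Type u} [NormedAddCommGroup E] [NormedSpace ℝ E]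

/-- The components of the metric `G` in the coordinates `F`, with respect to the vectors `e`. -/
def pullbackGram (G : E → E →L[ℝ] E →L[ℝ] ℝ) (F : E → E) {ι : Type*} (e : ι → E) (ξ : E) :
    Matrix ι ι ℝ :=
  Matrix.of fun i j => G (F ξ) (fderiv ℝ F ξ (e i)) (fderiv ℝ F ξ (e j))

variable {G : E → E →L[ℝ] E →L[ℝ] ℝ} {U : Set E} {p : E} {F : E → E} {r : ℝ}
  {ι : Type*} [DecidableEq ι] {e : Module.Basis ι ℝ E}

theorem IsMetricOn.pullbackGram_zero (hF : IsLocalExponential G U p F r)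
    (he : ∀ i j, G p (e i) (e j) = if i = j then 1 else 0) : pullbackGram G F e 0 = 1 := by
  ext i j
  simp [pullbackGram, hF.map_zero, hF.hasFDerivAt_zero.fderiv, he, Matrix.one_apply]

variable [Fintype ι]

/-- The Gram matrix of the image of an orthonormal basis under `a` is `AᵀA`, `A` the matrix of `a`. -/
theorem det_gram_comp (he : ∀ i j, G p (e i) (e j) = if i = j then 1 else 0) (a : E →L[ℝ] E) :
    (Matrix.of fun i j => G p (a (e i)) (a (e j))).det = LinearMap.det (a : E →ₗ[ℝ] E) ^ 2 := by
  have h1 : (Matrix.of fun i j => G p (a (e i)) (a (e j))) =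
      (LinearMap.toMatrix e e (a : E →ₗ[ℝ] E)).transpose *
        LinearMap.toMatrix e e (a : E →ₗ[ℝ] E) := by
    ext i j
    have h2 : ∀ i, a (e i) = ∑ k, LinearMap.toMatrix e e (a : E →ₗ[ℝ] E) k i • e k := by
      intro i
      simp only [LinearMap.toMatrix_apply]
      exact (e.sum_repr (a (e i))).symm
    rw [Matrix.of_apply, h2 i, h2 j]
    simp only [map_sum, map_smul, sum_apply, smul_apply, smul_eq_mul, he, mul_ite, mul_one,
      mul_zero, Finset.sum_ite_eq', Finset.mem_univ, if_true, Matrix.mul_apply,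
      Matrix.transpose_apply]
    exact Finset.sum_congr rfl fun _ _ => mul_comm _ _
  rw [h1, Matrix.det_mul, Matrix.det_transpose, LinearMap.det_toMatrix, pow_two]

theorem IsMetricOn.contDiffAt_sqrt_det_pullbackGram (h : IsMetricOn G U)
    (hF : IsLocalExponential G U p F r)
    (he : ∀ i j, G p (e i) (e j) = if i = j then 1 else 0) :
    ContDiffAt ℝ ∞ (fun ξ => √(pullbackGram G F e ξ).det) 0 := by
  have h0 : (0 : E) ∈ Metric.ball (0 : E) r := Metric.mem_ball_self hF.pos
  have hFs := hF.contDiffOn.contDiffAt (Metric.isOpen_ball.mem_nhds h0)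
  have hDF : ContDiffAt ℝ ∞ (fderiv ℝ F) 0 := hFs.fderiv_right (by simp)
  have hG : ContDiffAt ℝ ∞ (fun ξ => G (F ξ)) 0 := (h.contDiffAt (hF.mapsTo 0 h0)).comp 0 hFs
  refine ContDiffAt.sqrt ?_ ?_
  · simp only [Matrix.det_apply']
    refine ContDiffAt.sum fun σ _ => contDiffAt_const.mul (contDiffAt_prod fun i _ => ?_)
    exact (hG.clm_apply (hDF.clm_apply contDiffAt_const)).clm_apply
      (hDF.clm_apply contDiffAt_const)
  · rw [pullbackGram_zero hF he, Matrix.det_one]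
    exact one_ne_zero

variable [FiniteDimensional ℝ E]

/-- **Taylor expansion of the volume density in normal coordinates**, for a metric given in
coordinates, in terms of operators `J k` with `G(J k η, ζ) = ∇ᵏR(η, ξ, ξ, ζ; ξ, …, ξ)`. -/
theorem IsMetricOn.taylor_density (h : IsMetricOn G U) (hp : p ∈ U)
    (hF : IsLocalExponential G U p F r)
    (he : ∀ i j, G p (e i) (e j) = if i = j then 1 else 0) (ξ : E) {J : ℕ → E →L[ℝ] E}
    (hJ : ∀ k η ζ, G p (J k η) ζ = jacobiForm G p k ξ η ζ) :
    ∃ u : ℕ → E →L[ℝ] E, u 0 = 0 ∧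
      (∀ n : ℕ, ((n : ℝ) + 3) • u (n + 1) = -((n.factorial : ℝ)⁻¹ • J n +
        ∑ ij ∈ Finset.HasAntidiagonal.antidiagonal n, u ij.1 * u ij.2)) ∧
      taylorTerm (fun ξ => √(pullbackGram G F e ξ).det) 0 ξ = 1 ∧
      ∀ n : ℕ, ((n : ℝ) + 1) * taylorTerm (fun ξ => √(pullbackGram G F e ξ).det) (n + 1) ξ =
        ∑ ij ∈ Finset.HasAntidiagonal.antidiagonal n,
          taylorTerm (fun ξ => √(pullbackGram G F e ξ).det) ij.1 ξ * traceCLM (u ij.2) := by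
  obtain ⟨ε, hε, P, a, R, has, hRs, ha0, hfac, hiso, hjac, hR⟩ :=
    h.exists_jacobi_matrix hp hF ξ
  have hI : Set.Ioo (-ε) ε ∈ 𝓝 (0 : ℝ) := Ioo_mem_nhds (by linarith) hε
  have ha := has.contDiffAt hI
  obtain ⟨u, hu0, hu, hd⟩ := exists_riccati_coeff ha (hRs.contDiffAt hI) ha0
    (Filter.eventually_of_mem hI hjac)
  have hRJ : ∀ k, iteratedDeriv k R 0 = J k := by
    intro k
    ext η
    exact h.eq_of_forall_apply_eq hp fun ζ => by rw [hR, hJ]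
  simp only [hRJ] at hu
  -- near `0` the density along the ray is `det a`
  have hdet : (fun t : ℝ => √(pullbackGram G F e (t • ξ)).det) =ᶠ[𝓝 0]
      fun t => LinearMap.det (a t : E →ₗ[ℝ] E) := by
    have hc : ContinuousAt (fun t => LinearMap.det (a t : E →ₗ[ℝ] E)) 0 :=
      (contDiff_det (n := 0)).continuous.continuousAt.comp ha.continuousAt
    have hpos : ∀ᶠ t in 𝓝 (0 : ℝ), 0 < LinearMap.det (a t : E →ₗ[ℝ] E) := by
      refine hc.eventually (lt_mem_nhds ?_)
      change 0 < LinearMap.det (a 0 : E →ₗ[ℝ] E)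
      rw [ha0, ContinuousLinearMap.toLinearMap_one, map_one]
      exact one_pos
    filter_upwards [hI, hpos] with t ht htpos
    have h1 : pullbackGram G F e (t • ξ) = Matrix.of fun i j => G p (a t (e i)) (a t (e j)) := by
      ext i j
      simp only [pullbackGram, Matrix.of_apply, hfac t ht, hiso t ht]
    rw [h1, det_gram_comp he, Real.sqrt_sq htpos.le]
  have hT : ∀ k, taylorTerm (fun ξ => √(pullbackGram G F e ξ).det) k ξ =
      taylorCoeff (fun t => LinearMap.det (a t : E →ₗ[ℝ] E)) k := by
    intro k
    rw [taylorTerm_eq_taylorCoeff (h.contDiffAt_sqrt_det_pullbackGram hF he)]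
    exact taylorCoeff_congr hdet k
  refine ⟨u, hu0, hu, ?_, fun n => ?_⟩
  · rw [hT, taylorCoeff_zero, ha0, ContinuousLinearMap.toLinearMap_one, map_one]
  · simp only [hT]
    exact hd n

end Density

/-! ### A Riemannian metric in coordinates -/

section Manifold

variable {E : Type*} [NormedAddCommGroup E] [NormedSpace ℝ E]
  {M : Type*} [TopologicalSpace M] [ChartedSpace E M] [IsManifold 𝓘(ℝ, E) ∞ M]
  (g : Bundle.ContMDiffRiemannianMetric 𝓘(ℝ, E) ∞ E (fun x : M => TangentSpace 𝓘(ℝ, E) x))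

/-- The metric at the point `x`, as a bilinear form on the model space. -/
def metricAt (x : M) : E →L[ℝ] E →L[ℝ] ℝ := g.inner x

/-- The differential of a map into a manifold, with values in the model space. -/
def mfderivModel (ψ : E → M) (y : E) : E →L[ℝ] E := mfderiv 𝓘(ℝ, E) 𝓘(ℝ, E) ψ y

theorem metricInChart_apply (x₀ : M) (y u v : E) :
    metricInChart g x₀ y u v = metricAt g ((extChartAt 𝓘(ℝ, E) x₀).symm y)
      (mfderivModel (extChartAt 𝓘(ℝ, E) x₀).symm y u)
      (mfderivModel (extChartAt 𝓘(ℝ, E) x₀).symm y v) := rfl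

omit [IsManifold 𝓘(ℝ, E) ∞ M] in
theorem extChartAt_target_mem_nhds_of_mem {x₀ : M} {y : E}
    (hy : y ∈ (extChartAt 𝓘(ℝ, E) x₀).target) : (extChartAt 𝓘(ℝ, E) x₀).target ∈ 𝓝 y :=
  (isOpen_extChartAt_target x₀).mem_nhds hy

theorem contMDiffAt_extChartAt_symm {x₀ : M} {y : E}
    (hy : y ∈ (extChartAt 𝓘(ℝ, E) x₀).target) :
    ContMDiffAt 𝓘(ℝ, E) 𝓘(ℝ, E) ∞ (extChartAt 𝓘(ℝ, E) x₀).symm y :=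
  (contMDiffOn_extChartAt_symm x₀).contMDiffAt (extChartAt_target_mem_nhds_of_mem hy)

theorem mfderivModel_symm_injective {x₀ : M} {y : E}
    (hy : y ∈ (extChartAt 𝓘(ℝ, E) x₀).target) :
    Function.Injective (mfderivModel (extChartAt 𝓘(ℝ, E) x₀).symm y) := by
  have h := (isInvertible_mfderivWithin_extChartAt_symm (I := 𝓘(ℝ, E)) hy).injective
  have h2 : Set.range 𝓘(ℝ, E) = Set.univ := by simp
  rw [h2, mfderivWithin_univ] at h
  exact h

/-- The pull-back of the metric under a map `ψ` that is `F` in the chart at `x₀`. -/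
theorem metricAt_mfderivModel {x₀ : M} {ψ : E → M} {F : E → E} {y : E}
    (hy : F y ∈ (extChartAt 𝓘(ℝ, E) x₀).target) (hF : DifferentiableAt ℝ F y)
    (hψ : ψ =ᶠ[𝓝 y] (extChartAt 𝓘(ℝ, E) x₀).symm ∘ F) (u v : E) :
    metricAt g (ψ y) (mfderivModel ψ y u) (mfderivModel ψ y v) =
      metricInChart g x₀ (F y) (fderiv ℝ F y u) (fderiv ℝ F y v) := by
  have h1 : mfderivModel ψ y =
      (mfderivModel (extChartAt 𝓘(ℝ, E) x₀).symm (F y)).comp (fderiv ℝ F y) := by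
    have h2 := mfderiv_comp (I := 𝓘(ℝ, E)) (I' := 𝓘(ℝ, E)) (I'' := 𝓘(ℝ, E)) y
      ((contMDiffAt_extChartAt_symm hy).mdifferentiableAt (by simp)) hF.mdifferentiableAt
    rw [mfderiv_eq_fderiv] at h2
    have h3 : mfderivModel ψ y = mfderivModel ((extChartAt 𝓘(ℝ, E) x₀).symm ∘ F) y :=
      hψ.mfderiv_eq
    rw [h3]
    exact h2
  rw [metricInChart_apply, h1, hψ.eq_of_nhds]
  rfl

/-- In the preferred chart at `P` the metric at `P` is given by its values on tangent vectors. -/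
theorem metricInChart_self (P : M) :
    metricInChart g P (extChartAt 𝓘(ℝ, E) P P) = metricAt g P := by
  have h1 : mfderivModel (extChartAt 𝓘(ℝ, E) P).symm (extChartAt 𝓘(ℝ, E) P P) =
      ContinuousLinearMap.id ℝ E := by
    have h := mfderivWithin_range_extChartAt_symm (I := 𝓘(ℝ, E)) (x := P)
    have h2 : Set.range 𝓘(ℝ, E) = Set.univ := by simp
    rw [h2, mfderivWithin_univ] at h
    exact h
  ext u v
  rw [metricInChart_apply, h1, extChartAt_to_inv]
  rfl

/-- The coordinate vector fields of a chart are smooth. -/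
theorem contMDiffAt_mfderiv_extChartAt_symm {x₀ : M} {y : E}
    (hy : y ∈ (extChartAt 𝓘(ℝ, E) x₀).target) (w : E) :
    ContMDiffAt 𝓘(ℝ, E) (𝓘(ℝ, E).prod 𝓘(ℝ, E)) ∞
      (fun z => (⟨(extChartAt 𝓘(ℝ, E) x₀).symm z, mfderivModel (extChartAt 𝓘(ℝ, E) x₀).symm z w⟩ :
        TangentBundle 𝓘(ℝ, E) M)) y := by
  have ht := isOpen_extChartAt_target (I := 𝓘(ℝ, E)) x₀
  have h1 := (contMDiffOn_extChartAt_symm (n := ∞) (I := 𝓘(ℝ, E)) x₀).contMDiffOn_tangentMapWithin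
    (m := ∞) (by simp) ht.uniqueMDiffOn
  have h2 : ContMDiffAt 𝓘(ℝ, E) (𝓘(ℝ, E).prod 𝓘(ℝ, E)) ∞
      (fun z => (⟨z, w⟩ : TangentBundle 𝓘(ℝ, E) E)) y :=
    contMDiffAt_vectorSpace_iff_contDiffAt.2 contDiffAt_const
  have hy' : (Bundle.TotalSpace.proj : TangentBundle 𝓘(ℝ, E) E → E) ⁻¹'
      (extChartAt 𝓘(ℝ, E) x₀).target ∈ 𝓝 (⟨y, w⟩ : TangentBundle 𝓘(ℝ, E) E) :=
    (ht.preimage (FiberBundle.continuous_proj E (TangentSpace 𝓘(ℝ, E)))).mem_nhds hy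
  refine ((h1.contMDiffAt hy').comp y h2).congr_of_eventuallyEq ?_
  filter_upwards [ht.mem_nhds hy] with z hz
  simp only [Function.comp_apply, tangentMapWithin, mfderivWithin_of_isOpen ht hz]
  rfl

theorem contMDiffAt_metricInChart {x₀ : M} {y : E}
    (hy : y ∈ (extChartAt 𝓘(ℝ, E) x₀).target) (u v : E) :
    ContMDiffAt 𝓘(ℝ, E) 𝓘(ℝ, ℝ) ∞ (fun z => metricInChart g x₀ z u v) y := by
  have h4 : ContMDiffAt 𝓘(ℝ, E) (𝓘(ℝ, E).prod 𝓘(ℝ, ℝ)) ∞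
      (fun z => Bundle.TotalSpace.mk' ℝ (E := Bundle.Trivial M ℝ)
        ((extChartAt 𝓘(ℝ, E) x₀).symm z) (g.inner ((extChartAt 𝓘(ℝ, E) x₀).symm z)
      (mfderivModel (extChartAt 𝓘(ℝ, E) x₀).symm z u)
      (mfderivModel (extChartAt 𝓘(ℝ, E) x₀).symm z v))) y := by
    apply ContMDiffAt.clm_bundle_apply₂ (F₁ := E) (F₂ := E)
    · exact g.contMDiff.contMDiffAt.comp y (contMDiffAt_extChartAt_symm hy)
    · exact contMDiffAt_mfderiv_extChartAt_symm hy u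
    · exact contMDiffAt_mfderiv_extChartAt_symm hy v
  rw [Bundle.contMDiffAt_totalSpace] at h4
  exact h4.2

theorem metricInChart_symm (x₀ : M) (y u v : E) :
    metricInChart g x₀ y u v = metricInChart g x₀ y v u := by
  rw [metricInChart_apply, metricInChart_apply]
  exact g.symm _ _ _

theorem metricInChart_pos {x₀ : M} {y : E} (hy : y ∈ (extChartAt 𝓘(ℝ, E) x₀).target) {v : E}
    (hv : v ≠ 0) : 0 < metricInChart g x₀ y v v := by
  rw [metricInChart_apply]
  refine g.pos _ _ fun h => hv ?_
  exact (injective_iff_map_eq_zero _).1 (mfderivModel_symm_injective hy) v h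

variable [FiniteDimensional ℝ E]

theorem contDiffOn_metricInChart (x₀ : M) :
    ContDiffOn ℝ ∞ (metricInChart g x₀) (extChartAt 𝓘(ℝ, E) x₀).target := by
  refine contDiffOn_clm_apply.2 fun u => ?_
  refine contDiffOn_clm_apply.2 fun v => ?_
  intro y hy
  exact (contMDiffAt_metricInChart g hy u v).contDiffAt.contDiffWithinAt

theorem isMetricOn_metricInChart (x₀ : M) :
    IsMetricOn (metricInChart g x₀) (extChartAt 𝓘(ℝ, E) x₀).target where
  isOpen := isOpen_extChartAt_target x₀
  symm _ _ := metricInChart_symm g x₀ _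
  pos _ hy _ := metricInChart_pos g hy
  contDiffOn := contDiffOn_metricInChart g x₀

end Manifold

/-! ### Geodesics -/

section Geodesic

variable {E : Type*} [NormedAddCommGroup E] [NormedSpace ℝ E]
  {M : Type*} [TopologicalSpace M] [ChartedSpace E M] [IsManifold 𝓘(ℝ, E) ∞ M]
  {g : Bundle.ContMDiffRiemannianMetric 𝓘(ℝ, E) ∞ E (fun x : M => TangentSpace 𝓘(ℝ, E) x)}

theorem _root_.ContDiffAt.contDiffAt_deriv {F : Type*} [NormedAddCommGroup F] [NormedSpace ℝ F]
    {f : ℝ → F} {t : ℝ} (hf : ContDiffAt ℝ 2 f t) : ContDiffAt ℝ 1 (deriv f) t :=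
  (hf.fderiv_right (m := 1) (by norm_num)).clm_apply contDiffAt_const

theorem IsGeodesicOn.contMDiffAt {γ : ℝ → M} {s : Set ℝ} (h : IsGeodesicOn g γ s) {t : ℝ}
    (ht : t ∈ s) : ContMDiffAt 𝓘(ℝ, ℝ) 𝓘(ℝ, E) 2 γ t :=
  h.2.1.contMDiffAt (h.1.mem_nhds ht)

theorem IsGeodesicOn.contDiffAt_extChartAt {γ : ℝ → M} {s : Set ℝ} (h : IsGeodesicOn g γ s) {t : ℝ}
    (ht : t ∈ s) {x₀ : M} (hx : γ t ∈ (extChartAt 𝓘(ℝ, E) x₀).source) :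
    ContDiffAt ℝ 2 (extChartAt 𝓘(ℝ, E) x₀ ∘ γ) t := by
  rw [extChartAt_source] at hx
  exact ((contMDiffAt_extChartAt' (I := 𝓘(ℝ, E)) (n := 2) hx).comp t (h.contMDiffAt ht)).contDiffAt

/-- In a chart, a geodesic solves the first order system for position and velocity. -/
theorem IsGeodesicOn.eventually_hasDerivAt {γ : ℝ → M} {s : Set ℝ} (h : IsGeodesicOn g γ s) {t : ℝ}
    (ht : t ∈ s) {x₀ : M} (hx : γ t ∈ (extChartAt 𝓘(ℝ, E) x₀).source) :
    ∀ᶠ r in 𝓝 t, γ r ∈ (extChartAt 𝓘(ℝ, E) x₀).source ∧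
      HasDerivAt (fun r => (extChartAt 𝓘(ℝ, E) x₀ (γ r), deriv (extChartAt 𝓘(ℝ, E) x₀ ∘ γ) r))
        (deriv (extChartAt 𝓘(ℝ, E) x₀ ∘ γ) r,
          -christoffel (metricInChart g x₀) (extChartAt 𝓘(ℝ, E) x₀ (γ r))
            (deriv (extChartAt 𝓘(ℝ, E) x₀ ∘ γ) r) (deriv (extChartAt 𝓘(ℝ, E) x₀ ∘ γ) r)) r := by
  have h1 := (h.contMDiffAt ht).continuousAt.eventually
    ((isOpen_extChartAt_source (I := 𝓘(ℝ, E)) x₀).mem_nhds hx)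
  filter_upwards [h1, h.1.mem_nhds ht] with r hr hrs
  have hc := h.contDiffAt_extChartAt hrs hr
  have hd : HasDerivAt (extChartAt 𝓘(ℝ, E) x₀ ∘ γ) (deriv (extChartAt 𝓘(ℝ, E) x₀ ∘ γ) r) r :=
    (hc.differentiableAt (by simp)).hasDerivAt
  have hd2 : HasDerivAt (deriv (extChartAt 𝓘(ℝ, E) x₀ ∘ γ))
      (deriv (deriv (extChartAt 𝓘(ℝ, E) x₀ ∘ γ)) r) r := by
    exact (hc.contDiffAt_deriv.differentiableAt (by simp)).hasDerivAt
  rw [eq_neg_of_add_eq_zero_left (h.2.2 x₀ r hrs hr)] at hd2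
  exact ⟨hr, hd.prodMk hd2⟩

theorem IsGeodesicOn.continuousAt_deriv {γ : ℝ → M} {s : Set ℝ} (h : IsGeodesicOn g γ s) {t : ℝ}
    (ht : t ∈ s) {x₀ : M} (hx : γ t ∈ (extChartAt 𝓘(ℝ, E) x₀).source) :
    ContinuousAt (deriv (extChartAt 𝓘(ℝ, E) x₀ ∘ γ)) t :=
  (h.contDiffAt_extChartAt ht hx).contDiffAt_deriv.continuousAt

variable [FiniteDimensional ℝ E]

/-- Two geodesics that agree to first order at a parameter agree to first order near it. -/
theorem IsGeodesicOn.eventuallyEq {γ γ' : ℝ → M} {s s' : Set ℝ} (h : IsGeodesicOn g γ s)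
    (h' : IsGeodesicOn g γ' s') {t : ℝ} (ht : t ∈ s) (ht' : t ∈ s') {x₀ : M}
    (hx : γ t ∈ (extChartAt 𝓘(ℝ, E) x₀).source) (hγ : γ t = γ' t)
    (hd : deriv (extChartAt 𝓘(ℝ, E) x₀ ∘ γ) t = deriv (extChartAt 𝓘(ℝ, E) x₀ ∘ γ') t) :
    ∀ᶠ r in 𝓝 t, γ r = γ' r ∧
      deriv (extChartAt 𝓘(ℝ, E) x₀ ∘ γ) r = deriv (extChartAt 𝓘(ℝ, E) x₀ ∘ γ') r := by
  have hx' : γ' t ∈ (extChartAt 𝓘(ℝ, E) x₀).source := hγ ▸ hx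
  let V : E × E → E × E := fun z => (z.2, -christoffel (metricInChart g x₀) z.1 z.2 z.2)
  let c : (ℝ → M) → ℝ → E × E := fun γ r =>
    (extChartAt 𝓘(ℝ, E) x₀ (γ r), deriv (extChartAt 𝓘(ℝ, E) x₀ ∘ γ) r)
  have hc : c γ t = c γ' t := Prod.ext (congrArg (extChartAt 𝓘(ℝ, E) x₀) hγ) hd
  have hV : ContDiffAt ℝ 1 V (c γ t) := by
    have h1 : ContDiffAt ℝ 1 (christoffel (metricInChart g x₀)) (c γ t).1 :=
      ((isMetricOn_metricInChart g x₀).contDiffAt_christoffel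
        ((extChartAt 𝓘(ℝ, E) x₀).map_source hx)).of_le (by simp)
    exact contDiffAt_snd.prodMk
      (((h1.comp (c γ t) contDiffAt_fst).clm_apply contDiffAt_snd).clm_apply contDiffAt_snd).neg
  obtain ⟨K, S, hS, hK⟩ := hV.exists_lipschitzOnWith
  have hsol : ∀ {γ : ℝ → M} {s : Set ℝ}, IsGeodesicOn g γ s → t ∈ s →
      γ t ∈ (extChartAt 𝓘(ℝ, E) x₀).source → S ∈ 𝓝 (c γ t) →
      ∀ᶠ r in 𝓝 t, HasDerivAt (c γ) (V (c γ r)) r ∧ c γ r ∈ S := by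
    intro γ s h ht hx hS
    have h1 := h.eventually_hasDerivAt ht hx
    filter_upwards [h1, h1.self_of_nhds.2.continuousAt.eventually hS] with r hr hr'
    exact ⟨hr.2, hr'⟩
  have hE := ODE_solution_unique_of_eventually (v := fun _ => V) (s := fun _ => S)
    (Filter.Eventually.of_forall fun _ => hK) (hsol h ht hx hS) (hsol h' ht' hx' (hc ▸ hS)) hc
  filter_upwards [hE, h.eventually_hasDerivAt ht hx, h'.eventually_hasDerivAt ht' hx']
    with r hr h1 h2
  exact ⟨(extChartAt 𝓘(ℝ, E) x₀).injOn h1.1 h2.1 (congrArg Prod.fst hr), congrArg Prod.snd hr⟩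

/-- **Uniqueness of geodesics**, for a geodesic that stays in one chart domain. -/
theorem IsGeodesicFrom.eq_of_mem_source [T2Space M] {P : M} {ξ : E} {γ γ' : ℝ → M}
    (h : IsGeodesicFrom g P ξ γ) (h' : IsGeodesicFrom g P ξ γ')
    (hγ : ∀ t ∈ Set.Icc (0 : ℝ) 1, γ t ∈ (extChartAt 𝓘(ℝ, E) P).source) : γ 1 = γ' 1 := by
  obtain ⟨⟨a, b, ha, hb, hg⟩, h0, hξ⟩ := h
  obtain ⟨⟨a', b', ha', hb', hg'⟩, h0', hξ'⟩ := h'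
  have hI : ∀ t ∈ Set.Icc (0 : ℝ) 1, t ∈ Set.Ioo a b := fun t ht =>
    ⟨ha.trans_le ht.1, ht.2.trans_lt hb⟩
  have hI' : ∀ t ∈ Set.Icc (0 : ℝ) 1, t ∈ Set.Ioo a' b' := fun t ht =>
    ⟨ha'.trans_le ht.1, ht.2.trans_lt hb'⟩
  let d : (ℝ → M) → ℝ → E := fun γ => deriv (extChartAt 𝓘(ℝ, E) P ∘ γ)
  let A : Set ℝ := {t | γ t = γ' t} ∩ Set.Icc 0 1
  have hA : IsClosed A := by
    have h1 : ContinuousOn (fun t => (γ t, γ' t)) (Set.Icc 0 1) := fun t ht =>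
      ((hg.contMDiffAt (hI t ht)).continuousAt.prodMk
        (hg'.contMDiffAt (hI' t ht)).continuousAt).continuousWithinAt
    change IsClosed ({t | γ t = γ' t} ∩ Set.Icc 0 1)
    rw [Set.inter_comm]
    exact h1.preimage_isClosed_of_isClosed isClosed_Icc isClosed_diagonal
  have hd : ContinuousOn (fun t => d γ t - d γ' t) A := fun t ht =>
    ((hg.continuousAt_deriv (hI t ht.2) (hγ t ht.2)).sub
      (hg'.continuousAt_deriv (hI' t ht.2) (ht.1 ▸ hγ t ht.2))).continuousWithinAt
  let S : Set ℝ := {t | γ t = γ' t ∧ d γ t = d γ' t}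
  have hS : IsClosed (S ∩ Set.Icc 0 1) := by
    have h1 := hd.preimage_isClosed_of_isClosed hA (isClosed_singleton (x := (0 : E)))
    convert h1 using 1
    ext t
    simp only [S, A, Set.mem_inter_iff, Set.mem_ofPred_eq, Set.mem_preimage,
      Set.mem_singleton_iff, sub_eq_zero]
    tauto
  have hsub := hS.Icc_subset_of_forall_mem_nhdsWithin (a := 0) (b := 1)
    ⟨h0.trans h0'.symm, hξ.trans hξ'.symm⟩ (by
      rintro t ⟨ht, ht1⟩
      have ht1' : t ∈ Set.Icc (0 : ℝ) 1 := Set.Ico_subset_Icc_self ht1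
      exact mem_nhdsWithin_of_mem_nhds
        (hg.eventuallyEq hg' (hI t ht1') (hI' t ht1') (hγ t ht1') ht.1 ht.2))
  exact (hsub (Set.right_mem_Icc.2 zero_le_one)).1

end Geodesic

/-! ### The exponential map -/

section ExpMap

theorem taylorTerm_congr {E : Type*} [NormedAddCommGroup E] [NormedSpace ℝ E] {f f' : E → ℝ}
    (h : f =ᶠ[𝓝 0] f') (k : ℕ) (ξ : E) : taylorTerm f k ξ = taylorTerm f' k ξ := by
  rw [taylorTerm, taylorTerm, (h.iteratedFDeriv ℝ k).eq_of_nhds]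

theorem IsLocalExponential.eventually_two_smul_mem {E : Type*} [NormedAddCommGroup E]
    [NormedSpace ℝ E] {G : E → E →L[ℝ] E →L[ℝ] ℝ} {U : Set E} {p : E} {F : E → E} {r : ℝ}
    (hF : IsLocalExponential G U p F r) :
    ∀ᶠ ξ in 𝓝 (0 : E), (2 : ℝ) • ξ ∈ Metric.ball (0 : E) r := by
  have h : ContinuousAt (fun ξ : E => (2 : ℝ) • ξ) 0 := by fun_prop
  refine h.eventually (Metric.isOpen_ball.mem_nhds ?_)
  simpa using hF.pos

variable {E : Type*} [NormedAddCommGroup E] [NormedSpace ℝ E] [FiniteDimensional ℝ E]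
  {M : Type*} [TopologicalSpace M] [ChartedSpace E M] [IsManifold 𝓘(ℝ, E) ∞ M]
  {g : Bundle.ContMDiffRiemannianMetric 𝓘(ℝ, E) ∞ E (fun x : M => TangentSpace 𝓘(ℝ, E) x)}

/-- The transformation law of the Christoffel symbols makes the geodesic equation independent of the
chart: a solution `u` in the chart at `P` solves it in the chart at `x₀`. -/
theorem geodesic_equation_of_chart {P : M} {u v : ℝ → E} {t : ℝ}
    (hu : ∀ᶠ s in 𝓝 t, HasDerivAt u (v s) s)
    (hv : HasDerivAt v (-christoffel (metricInChart g P) (u t) (v t) (v t)) t)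
    (hut : u t ∈ (extChartAt 𝓘(ℝ, E) P).target) {x₀ : M}
    (hx : (extChartAt 𝓘(ℝ, E) P).symm (u t) ∈ (extChartAt 𝓘(ℝ, E) x₀).source) :
    deriv (deriv (extChartAt 𝓘(ℝ, E) x₀ ∘ fun s => (extChartAt 𝓘(ℝ, E) P).symm (u s))) t
      + christoffel (metricInChart g x₀)
          (extChartAt 𝓘(ℝ, E) x₀ ((extChartAt 𝓘(ℝ, E) P).symm (u t)))
          (deriv (extChartAt 𝓘(ℝ, E) x₀ ∘ fun s => (extChartAt 𝓘(ℝ, E) P).symm (u s)) t)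
          (deriv (extChartAt 𝓘(ℝ, E) x₀ ∘ fun s => (extChartAt 𝓘(ℝ, E) P).symm (u s)) t) = 0 := by
  let τ : E → E := fun y => extChartAt 𝓘(ℝ, E) x₀ ((extChartAt 𝓘(ℝ, E) P).symm y)
  change deriv (deriv (fun s => τ (u s))) t + christoffel (metricInChart g x₀) (τ (u t))
    (deriv (fun s => τ (u s)) t) (deriv (fun s => τ (u s)) t) = 0
  have hτ : ContDiffAt ℝ ∞ τ (u t) := by
    rw [extChartAt_source] at hx
    exact ((contMDiffAt_extChartAt' hx).comp (u t) (contMDiffAt_extChartAt_symm hut)).contDiffAt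
  -- the metric in the chart at `P` is the pull-back under the change of coordinates `τ`
  have hτd : ∀ᶠ y in 𝓝 (u t), DifferentiableAt ℝ τ y := by
    have h1 : ContDiffAt ℝ 1 τ (u t) := hτ.of_le (by simp)
    filter_upwards [h1.eventually (by simp)] with y hy
    exact hy.differentiableAt (by simp)
  have hsrc : ∀ᶠ y in 𝓝 (u t), y ∈ (extChartAt 𝓘(ℝ, E) P).target ∧
      (extChartAt 𝓘(ℝ, E) P).symm y ∈ (extChartAt 𝓘(ℝ, E) x₀).source :=
    Filter.Eventually.and (extChartAt_target_mem_nhds_of_mem hut)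
      ((contMDiffAt_extChartAt_symm hut).continuousAt.eventually
        ((isOpen_extChartAt_source (I := 𝓘(ℝ, E)) x₀).mem_nhds hx))
  have hG : ∀ᶠ y in 𝓝 (u t), ∀ a b, metricInChart g P y a b =
      metricInChart g x₀ (τ y) (fderiv ℝ τ y a) (fderiv ℝ τ y b) := by
    filter_upwards [hτd, hsrc, hsrc.eventually_nhds] with y hy hy' hy'' a b
    rw [metricInChart_apply]
    refine metricAt_mfderivModel g ((extChartAt 𝓘(ℝ, E) x₀).map_source hy'.2) hy ?_ a b
    filter_upwards [hy''] with z hz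
    exact ((extChartAt 𝓘(ℝ, E) x₀).left_inv hz.2).symm
  have hinj : Function.Injective (fderiv ℝ τ (u t)) := by
    rw [injective_iff_map_eq_zero]
    intro a ha
    by_contra hne
    have h1 := (isMetricOn_metricInChart g P).pos _ hut a hne
    rw [hG.self_of_nhds, ha, map_zero] at h1
    exact lt_irrefl _ h1
  have hsurj : Function.Surjective (fderiv ℝ τ (u t)) :=
    LinearMap.surjective_of_injective (f := (fderiv ℝ τ (u t)).toLinearMap) hinj
  have hlaw := christoffel_transform (isMetricOn_metricInChart g P) (isMetricOn_metricInChart g x₀)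
    hut ((extChartAt 𝓘(ℝ, E) x₀).map_source hx) (contDiffAt_infty.1 hτ 2) hsurj hG (v t) (v t)
  have hd : deriv (fun s => τ (u s)) =ᶠ[𝓝 t] fun s => fderiv ℝ τ (u s) (v s) := by
    filter_upwards [hu, hu.self_of_nhds.continuousAt.eventually hτd] with s hs hs'
    exact (hs'.hasFDerivAt.comp_hasDerivAt s hs).deriv
  have hdd : HasDerivAt (fun s => fderiv ℝ τ (u s) (v s))
      (fderiv ℝ (fderiv ℝ τ) (u t) (v t) (v t) +
        fderiv ℝ τ (u t) (-christoffel (metricInChart g P) (u t) (v t) (v t))) t := by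
    have h1 : HasFDerivAt (fderiv ℝ τ) (fderiv ℝ (fderiv ℝ τ) (u t)) (u t) :=
      ((hτ.fderiv_right (m := ∞) (by simp)).differentiableAt (by simp)).hasFDerivAt
    exact (h1.comp_hasDerivAt t hu.self_of_nhds).clm_apply hv
  rw [hd.deriv_eq, hdd.deriv, hd.eq_of_nhds, map_neg, hlaw]
  abel

variable {P : M} {F : E → E} {r : ℝ}

/-- The radial curves of the exponential map in coordinates are geodesics. -/
theorem IsLocalExponential.isGeodesicFrom
    (hF : IsLocalExponential (metricInChart g P) (extChartAt 𝓘(ℝ, E) P).target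
      (extChartAt 𝓘(ℝ, E) P P) F r) {ξ : E} (hξ : (2 : ℝ) • ξ ∈ Metric.ball (0 : E) r) :
    IsGeodesicFrom g P ξ fun t => (extChartAt 𝓘(ℝ, E) P).symm (F (t • ξ)) := by
  obtain ⟨v, hv, -⟩ := hF.radial ξ 2 two_pos hξ
  have hball : ∀ t ∈ Set.Ioo (-2 : ℝ) 2, t • ξ ∈ Metric.ball (0 : E) r := fun t ht =>
    smul_mem_ball_of_abs_lt hξ (abs_lt.2 ht)
  refine ⟨⟨-2, 2, by norm_num, by norm_num, isOpen_Ioo, ?_, ?_⟩, ?_, ?_⟩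
  · intro t ht
    have h1 : ContDiffAt ℝ ∞ (fun t : ℝ => F (t • ξ)) t :=
      (hF.contDiffOn.contDiffAt (Metric.isOpen_ball.mem_nhds (hball t ht))).comp t
        (contDiffAt_id.smul contDiffAt_const)
    exact (contMDiffAt_infty.1 ((contMDiffAt_extChartAt_symm (hF.mapsTo _ (hball t ht))).comp t
      h1.contMDiffAt) 2).contMDiffWithinAt
  · intro x₀ t ht hx
    refine geodesic_equation_of_chart (u := fun t => F (t • ξ)) ?_ (hv t (abs_lt.2 ht)).2
      (hF.mapsTo _ (hball t ht)) hx
    filter_upwards [isOpen_Ioo.mem_nhds ht] with s hs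
    exact (hv s (abs_lt.2 hs)).1
  · simp [hF.map_zero]
  · have h1 : (extChartAt 𝓘(ℝ, E) P ∘ fun t : ℝ => (extChartAt 𝓘(ℝ, E) P).symm (F (t • ξ)))
        =ᶠ[𝓝 0] fun t => F (t • ξ) := by
      filter_upwards [Ioo_mem_nhds (show (-2 : ℝ) < 0 by norm_num) two_pos] with t ht
      exact (extChartAt 𝓘(ℝ, E) P).right_inv (hF.mapsTo _ (hball t ht))
    have h2 : HasDerivAt (fun t : ℝ => t • ξ) ((1 : ℝ) • ξ) 0 := (hasDerivAt_id 0).smul_const ξ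
    have h3 : HasFDerivAt F (ContinuousLinearMap.id ℝ E) ((0 : ℝ) • ξ) := by
      rw [zero_smul]
      exact hF.hasFDerivAt_zero
    have h4 : HasDerivAt (fun t : ℝ => F (t • ξ)) ((1 : ℝ) • ξ) 0 := by
      exact h3.comp_hasDerivAt (0 : ℝ) h2
    rw [h1.deriv_eq, h4.deriv, one_smul]

theorem IsLocalExponential.expMap_eq [T2Space M]
    (hF : IsLocalExponential (metricInChart g P) (extChartAt 𝓘(ℝ, E) P).target
      (extChartAt 𝓘(ℝ, E) P P) F r) {ξ : E} (hξ : (2 : ℝ) • ξ ∈ Metric.ball (0 : E) r) :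
    expMap g P ξ = (extChartAt 𝓘(ℝ, E) P).symm (F ξ) := by
  have h1 := hF.isGeodesicFrom hξ
  have h2 : ∃ γ : ℝ → M, IsGeodesicFrom g P ξ γ := ⟨_, h1⟩
  rw [expMap, dif_pos h2, ← h1.eq_of_mem_source h2.choose_spec, one_smul]
  intro t ht
  refine (extChartAt 𝓘(ℝ, E) P).map_target (hF.mapsTo _ (smul_mem_ball_of_abs_lt hξ ?_))
  rw [abs_of_nonneg ht.1]
  exact ht.2.trans_lt one_lt_two

/-- Near `0` the components of the metric in normal coordinates are those of the coordinate
expression of the metric pulled back under `F`. -/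
theorem IsLocalExponential.normalMetric_eventuallyEq [T2Space M]
    (hF : IsLocalExponential (metricInChart g P) (extChartAt 𝓘(ℝ, E) P).target
      (extChartAt 𝓘(ℝ, E) P P) F r) {ι : Type*} (e : ι → E) :
    ∀ᶠ ξ in 𝓝 (0 : E), normalMetric g P e ξ = pullbackGram (metricInChart g P) F e ξ := by
  filter_upwards [hF.eventually_two_smul_mem.eventually_nhds,
    Metric.ball_mem_nhds (0 : E) hF.pos] with ξ hξ hξr
  have h1 : expMap g P =ᶠ[𝓝 ξ] (extChartAt 𝓘(ℝ, E) P).symm ∘ F := by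
    filter_upwards [hξ] with ζ hζ
    exact hF.expMap_eq hζ
  have h2 : DifferentiableAt ℝ F ξ :=
    (hF.contDiffOn.contDiffAt (Metric.isOpen_ball.mem_nhds hξr)).differentiableAt (by simp)
  ext i j
  exact metricAt_mfderivModel g (hF.mapsTo ξ hξr) h2 h1 (e i) (e j)

end ExpMap

end RiemannianTaylor

end

open RiemannianTaylor in
theorem theorem1p1
    {E : Type*} [NormedAddCommGroup E] [NormedSpace ℝ E] [FiniteDimensional ℝ E]
    {M : Type*} [TopologicalSpace M] [T2Space M] [ChartedSpace E M] [IsManifold 𝓘(ℝ, E) ∞ M]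
    (g : Bundle.ContMDiffRiemannianMetric 𝓘(ℝ, E) ∞ E (fun x : M => TangentSpace 𝓘(ℝ, E) x))
    (P : M) {m : ℕ} (e : Module.Basis (Fin m) ℝ E)
    (he : ∀ i j, g.inner P (e i) (e j) = if i = j then 1 else 0) :
    -- the exponential map is defined, and the volume density is smooth, near the origin
    (∀ᶠ ξ in 𝓝 (0 : E), ξ ∈ expDomain g P) ∧
    ContDiffAt ℝ ∞ (volumeDensity g P e) 0 ∧
    ∀ ξ : E,
      let H : ℕ → ℝ := fun k => taylorTerm (volumeDensity g P e) k ξ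
      let J : ℕ → Module.End ℝ E := fun k => jacobiOperator g P k ξ
      let Tr : Module.End ℝ E → ℝ := fun A => LinearMap.trace ℝ E A
      H 0 = 1 ∧
      H 1 = 0 ∧
      H 2 = -Tr (J 0) / 6 ∧
      H 3 = -Tr (J 1) / 12 ∧
      H 4 = Tr (J 0) ^ 2 / 72 - Tr (J 0 ^ 2) / 180 - Tr (J 2) / 40 ∧
      H 5 = Tr (J 0) * Tr (J 1) / 72 - Tr (J 0 * J 1) / 180 - Tr (J 3) / 180 ∧
      H 6 = -Tr (J 0) ^ 3 / 1296 + Tr (J 0) * Tr (J 0 ^ 2) / 1080 + Tr (J 0) * Tr (J 2) / 240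
        - Tr (J 0 ^ 3) / 2835 - Tr (J 0 * J 2) / 630 + Tr (J 1) ^ 2 / 288
        - Tr (J 1 ^ 2) / 672 - Tr (J 4) / 1008 ∧
      H 7 = Tr (J 0) * Tr (J 0 * J 1) / 1080 - Tr (J 0) ^ 2 * Tr (J 1) / 864 - Tr (J 5) / 6720
        + Tr (J 0) * Tr (J 3) / 1080 + Tr (J 0 ^ 2) * Tr (J 1) / 2160
        - Tr (J 0 ^ 2 * J 1) / 1890 - Tr (J 0 * J 3) / 3024 + Tr (J 1) * Tr (J 2) / 480
        - Tr (J 1 * J 2) / 1120 ∧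
      H 8 = Tr (J 0) ^ 4 / 31104 - Tr (J 0) ^ 2 * Tr (J 0 ^ 2) / 12960
        - Tr (J 0) ^ 2 * Tr (J 2) / 2880
        + Tr (J 0) * Tr (J 0 ^ 3) / 17010 + Tr (J 0) * Tr (J 0 * J 2) / 3780
        - Tr (J 6) / 51840
        - Tr (J 0) * Tr (J 1) ^ 2 / 1728 + Tr (J 0) * Tr (J 1 ^ 2) / 4032
        - Tr (J 2 ^ 2) / 7200 + Tr (J 0) * Tr (J 4) / 6048
        + Tr (J 0 ^ 2) * Tr (J 2) / 7200
        + Tr (J 0 ^ 2) ^ 2 / 64800 - Tr (J 0 ^ 4) / 37800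
        - 17 * Tr (J 0 ^ 2 * J 2) / 113400
        + Tr (J 0 * J 1) * Tr (J 1) / 2160 - 5 * Tr (J 0 * J 1 ^ 2) / 18144
        - Tr (J 0 * J 4) / 18144
        + Tr (J 1) * Tr (J 3) / 2160 - Tr (J 1 * J 3) / 5184
        + Tr (J 2) ^ 2 / 3200 := by
  have hg := isMetricOn_metricInChart g P
  have hp := mem_extChartAt_target (I := 𝓘(ℝ, E)) P
  obtain ⟨F, r, hF⟩ := hg.exists_localExponential hp
  have he' : ∀ i j, metricInChart g P (extChartAt 𝓘(ℝ, E) P P) (e i) (e j) =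
      if i = j then 1 else 0 := by
    rw [metricInChart_self]
    exact he
  have hV : volumeDensity g P e =ᶠ[𝓝 0] fun ξ => √(pullbackGram (metricInChart g P) F e ξ).det := by
    filter_upwards [hF.normalMetric_eventuallyEq e] with ξ hξ
    rw [volumeDensity, hξ]
  refine ⟨?_, (hg.contDiffAt_sqrt_det_pullbackGram hF he').congr_of_eventuallyEq hV, ?_⟩
  · filter_upwards [hF.eventually_two_smul_mem] with ξ hξ
    exact ⟨_, hF.isGeodesicFrom hξ⟩
  intro ξ H J Tr
  let j : ℕ → E →L[ℝ] E := fun k => LinearMap.toContinuousLinearMap (J k)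
  have hj : ∀ k, (j k : E →ₗ[ℝ] E) = J k := fun _ => rfl
  have hjac : ∀ k η ζ, metricInChart g P (extChartAt 𝓘(ℝ, E) P P) (j k η) ζ =
      jacobiForm (metricInChart g P) (extChartAt 𝓘(ℝ, E) P P) k ξ η ζ := by
    rw [metricInChart_self]
    exact fun k => inner_jacobiOperator g P k ξ
  obtain ⟨u, hu0, hu, hd0, hd⟩ := hg.taylor_density hp hF he' ξ hjac
  simp only [← taylorTerm_congr hV] at hd0 hd
  have key := density_coeff (τ := traceCLM.toLinearMap) (u := u) (J := j) traceCLM_mul_comm hu0 hu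
    (d := H) hd0 hd
  simp only [ContinuousLinearMap.coe_coe, traceCLM_apply, ContinuousLinearMap.toLinearMap_mul,
    ContinuousLinearMap.toLinearMap_pow, hj] at key
  exact ⟨hd0, key⟩
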